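/- Let $n\ge 1$ and let $\Sigma_n=\{([y_1,y_2],[x_1,x_2,x_3])\in\mathbb P^1\times\mathbb P^2 \mid x_1y_1^n=x_2y_2^n\}$ be the $n$-th Hirzebruch surface over $\mathbb C$. Let $\mathfrak f$ be the class of a fibre of $\Sigma_n\to\mathbb P^1$, let $\mathfrak h$ and $\mathfrak e=\mathfrak h-n\mathfrak f$ be the classes of the sections of self-intersection $n$ and $-n$, and write $\mathcal O(a,b)=\mathcal O_{\Sigma_n}(a\mathfrak h+b\mathfrak f)$. Let $y_1,y_2\in H^0(\mathcal O(0,1))$ be the pull-backs of homogeneous coordinates on $\mathbb P^1$, let $s_{\mathfrak e}\in H^0(\mathcal O(1,-n))$ be a nonzero section (unique up to scalars), and let $s_\infty\in H^0(\mathcal O(1,0))$ be a section whose vanishing locus is a curve $\ell_\infty$ that is the image of a section of $\Sigma_n\to\mathbb P^1$ of class $\mathfrak h$. Let $V$ be a complex vector space of finite dimension $c$ and let $b_1,b_2\in\operatorname{End}(V)$ commute, with transposes $b_1^*,b_2^*\in\operatorname{End}(V^*)$. Consider the three-term complex of sheaves of $\mathcal O_{\Sigma_n}$-modules, placed in degrees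 $-1,0,1$, $$M(X):\quad 0\to \mathcal O(0,-1)\otimes V^*\xrightarrow{\ \alpha\ }\bigl(\mathcal O(1,-1)\oplus\mathcal O_{\Sigma_n}\bigr)\otimes V^*\xrightarrow{\ \beta\ }\mathcal O(1,0)\otimes V^*\to 0,$$ $$\alpha=\begin{pmatrix}\operatorname{id}_{V^*}\,y_2^n s_{\mathfrak e}+b_2^*\,s_\infty\\ \operatorname{id}_{V^*}\,y_1+b_1^*\,y_2\end{pmatrix},\qquad \beta=\begin{pmatrix}\operatorname{id}_{V^*}\,y_1+b_1^*\,y_2, & -\bigl(\operatorname{id}_{V^*}\,y_2^n s_{\mathfrak e}+b_2^*\,s_\infty\bigr)\end{pmatrix}.$$ Then the cohomology sheaves of this complex satisfy $\mathcal H^{-1}(M(X))=\mathcal H^{0}(M(X))=0$. -/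

import Mathlib

open CategoryTheory CategoryTheory.Limits AlgebraicGeometry TopologicalSpace Opposite

noncomputable section

namespace Hirzebruch

/-! ### The Cox ring of the Hirzebruch surface and its grading -/

/-- The Cox ring `ℂ[y₁, y₂, s, t]`: the variables `0, 1, 2, 3` are `y₁, y₂, s, t`. -/
abbrev Cox : Type := MvPolynomial (Fin 4) ℂ

/-- The bidegrees of `y₁, y₂, s, t`, where `(a, b)` stands for the class `a 𝔥 + b 𝔣`:
`y₁, y₂` have degree `(0, 1)`, `s` has degree `(1, -n)` and `t` has degree `(1, 0)`. -/
def wt (n : ℕ) : Fin 4 → ℤ × ℤ := ![(0, 1), (0, 1), (1, -(n : ℤ)), (1, 0)]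

/-- The global sections of `𝒪(a, b)`: the bihomogeneous elements of degree `(a, b)` of the
Cox ring. -/
abbrev GlobalSections (n : ℕ) (d : ℤ × ℤ) : Submodule ℂ Cox :=
  MvPolynomial.weightedHomogeneousSubmodule ℂ (wt n) d

/-- The field of fractions of the Cox ring. -/
def CoxField : Type := FractionRing Cox

instance : Field CoxField := inferInstanceAs (Field (FractionRing Cox))

instance : Algebra Cox CoxField := inferInstanceAs (Algebra Cox (FractionRing Cox))

instance : IsFractionRing Cox CoxField := inferInstanceAs (IsFractionRing Cox (FractionRing Cox))

instance : Algebra ℂ CoxField :=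
  ((algebraMap Cox CoxField).comp (algebraMap ℂ Cox)).toAlgebra

instance : IsScalarTower ℂ Cox CoxField := IsScalarTower.of_algebraMap_eq' rfl

/-- The Laurent monomial `y₁ ^ m 0 * y₂ ^ m 1 * s ^ m 2 * t ^ m 3`. -/
def mon (m : Fin 4 → ℤ) : CoxField :=
  ∏ k, (algebraMap Cox CoxField (MvPolynomial.X k)) ^ m k

/-- The bidegree of a Laurent monomial. -/
def deg (n : ℕ) (m : Fin 4 → ℤ) : ℤ × ℤ := ∑ k, m k • wt n k

lemma algebraMap_X_ne_zero (k : Fin 4) :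
    algebraMap Cox CoxField (MvPolynomial.X k) ≠ 0 := by
  simp

lemma mon_ne_zero (m : Fin 4 → ℤ) : mon m ≠ 0 :=
  Finset.prod_ne_zero_iff.mpr fun k _ => zpow_ne_zero _ (algebraMap_X_ne_zero k)

@[simp] lemma mon_zero : mon 0 = 1 := by simp [mon]

lemma mon_add (m m' : Fin 4 → ℤ) : mon (m + m') = mon m * mon m' := by
  simp [mon, ← Finset.prod_mul_distrib, zpow_add₀ (algebraMap_X_ne_zero _)]

lemma mon_neg (m : Fin 4 → ℤ) : mon (-m) = (mon m)⁻¹ := by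
  simp [mon]

lemma mon_sub (m m' : Fin 4 → ℤ) : mon (m - m') = mon m / mon m' := by
  rw [sub_eq_add_neg, mon_add, mon_neg, div_eq_mul_inv]

lemma mon_nsmul (N : ℕ) (m : Fin 4 → ℤ) : mon (N • m) = mon m ^ N := by
  induction N with
  | zero => simp
  | succ N ih => rw [succ_nsmul, mon_add, ih, pow_succ]

lemma deg_add (n : ℕ) (m m' : Fin 4 → ℤ) : deg n (m + m') = deg n m + deg n m' := by
  simp [deg, add_smul, Finset.sum_add_distrib]

lemma deg_neg (n : ℕ) (m : Fin 4 → ℤ) : deg n (-m) = - deg n m := by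
  simp [deg]

lemma deg_sub (n : ℕ) (m m' : Fin 4 → ℤ) : deg n (m - m') = deg n m - deg n m' := by
  rw [sub_eq_add_neg, deg_add, deg_neg, sub_eq_add_neg]

lemma deg_nsmul (n N : ℕ) (m : Fin 4 → ℤ) : deg n (N • m) = N • deg n m := by
  induction N with
  | zero => simp [deg]
  | succ N ih => rw [succ_nsmul, deg_add, ih, succ_nsmul]

lemma deg_single (n : ℕ) (k : Fin 4) : deg n (Pi.single k 1) = wt n k := by
  simp [deg, Pi.single_apply]

/-! ### The affine charts -/

/-- The charts are indexed by the sets `I` of variables that are made invertible; `I` has to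
contain one of `y₁, y₂` and one of `s, t`. The four minimal such sets give the four affine
planes that cover the surface, the others give the intersections of these planes. -/
structure Chart where
  vars : Finset (Fin 4)
  base : 0 ∈ vars ∨ 1 ∈ vars
  fibre : 2 ∈ vars ∨ 3 ∈ vars

lemma Chart.ext_vars {I J : Chart} (h : I.vars = J.vars) : I = J := by
  cases I; cases J; cases h; rfl

instance : PartialOrder Chart where
  le I J := I.vars ⊆ J.vars
  le_refl I := Finset.Subset.refl _
  le_trans I J K := Finset.Subset.trans
  le_antisymm I J h h' := Chart.ext_vars (Finset.Subset.antisymm h h')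

instance : Finite Chart :=
  Finite.of_injective Chart.vars fun _ _ h => Chart.ext_vars h

/-- The Laurent monomials of degree zero in which the variables outside `I` have nonnegative
exponents. -/
def Chart.exps (n : ℕ) (I : Chart) : Set (Fin 4 → ℤ) :=
  {m | deg n m = 0 ∧ ∀ k, k ∉ I.vars → 0 ≤ m k}

/-- The coordinate ring of the chart `I`: the degree zero part of the Cox ring with the variables
in `I` inverted. -/
def Chart.ring (n : ℕ) (I : Chart) : Subalgebra ℂ CoxField :=
  Algebra.adjoin ℂ (mon '' I.exps n)

lemma Chart.exps_mono (n : ℕ) {I J : Chart} (h : I ≤ J) : I.exps n ⊆ J.exps n :=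
  fun _ hm => ⟨hm.1, fun k hk => hm.2 k fun hk' => hk (h hk')⟩

lemma Chart.ring_mono (n : ℕ) {I J : Chart} (h : I ≤ J) : I.ring n ≤ J.ring n :=
  Algebra.adjoin_mono (Set.image_mono (Chart.exps_mono n h))

lemma Chart.mon_mem (n : ℕ) {I : Chart} {m : Fin 4 → ℤ} (h : m ∈ I.exps n) :
    mon m ∈ I.ring n :=
  Algebra.subset_adjoin ⟨m, h, rfl⟩

/-- A monomial generator of `𝒪(a, b)` on the chart `I`: with `y` one of `y₁, y₂` in `I`, it is
`s ^ a * y ^ (b + n a)` if `s` is in `I`, and `t ^ a * y ^ b` otherwise. -/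
def Chart.gen (n : ℕ) (I : Chart) (d : ℤ × ℤ) : Fin 4 → ℤ :=
  (if 2 ∈ I.vars then Pi.single 2 d.1 else Pi.single 3 d.1) +
    Pi.single (if 0 ∈ I.vars then 0 else 1) (d.2 + if 2 ∈ I.vars then n * d.1 else 0)

lemma Chart.deg_gen (n : ℕ) (I : Chart) (d : ℤ × ℤ) : deg n (I.gen n d) = d := by
  unfold Chart.gen deg
  split_ifs <;> ext <;> simp [Fin.sum_univ_four, wt] <;> ring

lemma Chart.gen_apply_eq_zero (n : ℕ) (I : Chart) (d : ℤ × ℤ) {k : Fin 4} (hk : k ∉ I.vars) :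
    I.gen n d k = 0 := by
  have h1 := I.base
  have h2 := I.fibre
  unfold Chart.gen
  split_ifs <;> fin_cases k <;> simp_all

lemma Chart.gen_add (n : ℕ) (I : Chart) (d d' : ℤ × ℤ) :
    I.gen n (d + d') = I.gen n d + I.gen n d' := by
  unfold Chart.gen
  split_ifs <;> funext k <;> fin_cases k <;> simp <;> ring

/-- The transition function of `𝒪(a, b)` from the chart `I` to the smaller chart `J`. -/
def Chart.transition (n : ℕ) {I J : Chart} (h : I ≤ J) (d : ℤ × ℤ) : J.ring n :=
  ⟨mon (I.gen n d - J.gen n d), Chart.mon_mem n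
    ⟨by rw [deg_sub, Chart.deg_gen, Chart.deg_gen, sub_self], fun k hk => by
      rw [Pi.sub_apply, Chart.gen_apply_eq_zero n J d hk,
        Chart.gen_apply_eq_zero n I d fun hk' => hk (h hk'), sub_self]⟩⟩

lemma algebraMap_monomial (m : Fin 4 →₀ ℕ) (r : ℂ) :
    algebraMap Cox CoxField (MvPolynomial.monomial m r) =
      algebraMap ℂ CoxField r * mon (fun k => (m k : ℤ)) := by
  rw [MvPolynomial.monomial_eq, map_mul, Finsupp.prod_fintype _ _ (by simp), map_prod, mon,
    IsScalarTower.algebraMap_apply ℂ Cox CoxField]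
  simp [MvPolynomial.algebraMap_eq]

lemma deg_natCast (n : ℕ) (m : Fin 4 →₀ ℕ) :
    deg n (fun k => (m k : ℤ)) = Finsupp.weight (wt n) m := by
  simp [deg, Finsupp.weight_apply, Finsupp.sum_fintype]

lemma Chart.quotient_mem (n : ℕ) (I : Chart) {d : ℤ × ℤ} (f : GlobalSections n d) :
    algebraMap Cox CoxField f / mon (I.gen n d) ∈ I.ring n := by
  obtain ⟨f, hf⟩ := f
  rw [MvPolynomial.mem_weightedHomogeneousSubmodule] at hf
  dsimp only
  rw [f.as_sum, map_sum, Finset.sum_div]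
  refine Subalgebra.sum_mem _ fun m hm => ?_
  rw [algebraMap_monomial, mul_div_assoc, ← mon_sub]
  refine Subalgebra.mul_mem _ (Subalgebra.algebraMap_mem _ _) (Chart.mon_mem n ⟨?_, fun k hk => ?_⟩)
  · rw [deg_sub, Chart.deg_gen, deg_natCast, hf (MvPolynomial.mem_support_iff.mp hm), sub_self]
  · rw [Pi.sub_apply, Chart.gen_apply_eq_zero n I d hk, sub_zero]
    exact Int.natCast_nonneg _

/-- The regular function that represents the section `f` of `𝒪(a, b)` on the chart `I`, with
respect to the chosen generator. -/
def Chart.local (n : ℕ) (I : Chart) {d : ℤ × ℤ} (f : GlobalSections n d) : I.ring n :=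
  ⟨algebraMap Cox CoxField f / mon (I.gen n d), I.quotient_mem n f⟩

/-! ### Gluing the charts -/

/-- For `I ≤ J`, a monomial on the chart `I` whose nonvanishing locus is the chart `J`. -/
def Chart.locus (n : ℕ) (I J : Chart) : Fin 4 → ℤ :=
  ∑ k ∈ J.vars \ I.vars, (Pi.single k 1 - I.gen n (wt n k))

lemma Chart.deg_locus (n : ℕ) (I J : Chart) : deg n (Chart.locus n I J) = 0 := by
  unfold Chart.locus
  refine Finset.sum_induction _ (fun m => deg n m = 0) (fun a b ha hb => ?_) (by simp [deg])
    fun k _ => ?_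
  · rw [deg_add, ha, hb, add_zero]
  · rw [deg_sub, Chart.deg_gen, deg_single, sub_self]

lemma Chart.locus_apply (n : ℕ) (I J : Chart) {k : Fin 4} (hk : k ∉ I.vars) :
    Chart.locus n I J k = if k ∈ J.vars then 1 else 0 := by
  unfold Chart.locus
  rw [Finset.sum_apply, Finset.sum_congr rfl fun j _ => show _ = if k = j then (1 : ℤ) else 0 by
    rw [Pi.sub_apply, Chart.gen_apply_eq_zero n I _ hk, sub_zero, Pi.single_apply]]
  simp [hk]

lemma Chart.locus_mem (n : ℕ) (I J : Chart) : Chart.locus n I J ∈ I.exps n :=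
  ⟨Chart.deg_locus n I J, fun k hk => by rw [Chart.locus_apply n I J hk]; split_ifs <;> simp⟩

lemma Chart.exists_pow_mul_mem (n : ℕ) {I J : Chart} (m : Fin 4 → ℤ)
    (hm : m ∈ I.exps n) (h0 : ∀ k, k ∉ J.vars → m k = 0)
    (h1 : ∀ k, k ∈ J.vars → k ∉ I.vars → 0 < m k) (x : CoxField) (hx : x ∈ J.ring n) :
    ∃ N : ℕ, mon m ^ N * x ∈ I.ring n := by
  unfold Chart.ring at hx
  induction hx using Algebra.adjoin_induction with
  | mem x hx =>
    obtain ⟨e, he, rfl⟩ := hx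
    refine ⟨∑ k, (e k).natAbs, ?_⟩
    rw [← mon_nsmul, ← mon_add]
    refine Chart.mon_mem n ⟨?_, fun k hk => ?_⟩
    · rw [deg_add, he.1, deg_nsmul, hm.1, smul_zero, add_zero]
    · rw [Pi.add_apply, Pi.smul_apply]
      by_cases hkJ : k ∈ J.vars
      · have h2 : (e k).natAbs ≤ ∑ k, (e k).natAbs :=
          Finset.single_le_sum (f := fun k => (e k).natAbs) (fun _ _ => Nat.zero_le _)
            (Finset.mem_univ k)
        have h3 := h1 k hkJ hk
        have h4 : ((∑ k, (e k).natAbs : ℕ) : ℤ) ≤ (∑ k, (e k).natAbs) • m k := by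
          rw [nsmul_eq_mul]
          exact le_mul_of_one_le_right (Int.natCast_nonneg _) h3
        omega
      · rw [h0 k hkJ, smul_zero, zero_add]
        exact he.2 k hkJ
  | algebraMap r => exact ⟨0, by simp⟩
  | add x y _ _ hx hy =>
    obtain ⟨N, hN⟩ := hx
    obtain ⟨M, hM⟩ := hy
    refine ⟨M + N, ?_⟩
    have e : mon m ^ (M + N) * (x + y) =
        mon m ^ M * (mon m ^ N * x) + mon m ^ N * (mon m ^ M * y) := by ring
    rw [e]
    exact add_mem (mul_mem (pow_mem (Chart.mon_mem n hm) _) hN)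
      (mul_mem (pow_mem (Chart.mon_mem n hm) _) hM)
  | mul x y _ _ hx hy =>
    obtain ⟨N, hN⟩ := hx
    obtain ⟨M, hM⟩ := hy
    refine ⟨N + M, ?_⟩
    have e : mon m ^ (N + M) * (x * y) = (mon m ^ N * x) * (mon m ^ M * y) := by ring
    rw [e]
    exact mul_mem hN hM

/-- The restriction of functions from a chart to a smaller one. -/
def Chart.res (n : ℕ) {I J : Chart} (h : I ≤ J) : I.ring n →+* J.ring n :=
  (Subalgebra.inclusion (Chart.ring_mono n h)).toRingHom

lemma Chart.coe_res (n : ℕ) {I J : Chart} (h : I ≤ J) (a : I.ring n) :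
    ((Chart.res n h a : J.ring n) : CoxField) = a :=
  Subalgebra.coe_inclusion (Chart.ring_mono n h) a

lemma Chart.isLocalization (n : ℕ) {I J : Chart} (h : I ≤ J) (m : Fin 4 → ℤ)
    (hm : m ∈ I.exps n) (h0 : ∀ k, k ∉ J.vars → m k = 0)
    (h1 : ∀ k, k ∈ J.vars → k ∉ I.vars → 0 < m k) :
    letI := (Chart.res n h).toAlgebra
    IsLocalization.Away (⟨mon m, Chart.mon_mem n hm⟩ : I.ring n) (J.ring n) := by
  let _ := (Chart.res n h).toAlgebra
  have hneg : mon (-m) ∈ J.ring n := Chart.mon_mem n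
    ⟨by rw [deg_neg, hm.1, neg_zero], fun k hk => by simp [h0 k hk]⟩
  refine ⟨?_, ?_, ?_⟩
  · rintro ⟨_, N, rfl⟩
    refine IsUnit.of_mul_eq_one (⟨mon (-m), hneg⟩ ^ N) (Subtype.ext ?_)
    rw [RingHom.algebraMap_toAlgebra, MulMemClass.coe_mul, Chart.coe_res, SubmonoidClass.coe_pow,
      SubmonoidClass.coe_pow, ← mul_pow]
    change (mon m * mon (-m)) ^ N = 1
    rw [mon_neg, mul_inv_cancel₀ (mon_ne_zero m), one_pow]
  · rintro ⟨x, hx⟩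
    obtain ⟨N, hN⟩ := Chart.exists_pow_mul_mem n m hm h0 h1 x hx
    refine ⟨(⟨_, hN⟩, ⟨_, N, rfl⟩), Subtype.ext ?_⟩
    rw [RingHom.algebraMap_toAlgebra, MulMemClass.coe_mul, Chart.coe_res, SubmonoidClass.coe_pow,
      Chart.coe_res, mul_comm]
  · intro a b hab
    refine ⟨1, ?_⟩
    have h2 : ((Chart.res n h a : J.ring n) : CoxField) = Chart.res n h b := congrArg Subtype.val hab
    rw [Chart.coe_res, Chart.coe_res] at h2
    rw [Subtype.ext h2]

/-- The coordinate rings of the charts, with the restriction maps. -/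
def coordRing (n : ℕ) : Chart ⥤ CommRingCat.{0} where
  obj I := CommRingCat.of (I.ring n)
  map f := CommRingCat.ofHom (Chart.res n (leOfHom f))

/-- The affine charts `Spec (I.ring n)`, with the inclusions of the smaller charts. -/
def charts (n : ℕ) : Chartᵒᵖ ⥤ Scheme.{0} := (coordRing n).op ⋙ Scheme.Spec

lemma charts_map_range (n : ℕ) {I J : Chart} (h : I ≤ J) (m : Fin 4 → ℤ)
    (hm : m ∈ I.exps n) (h0 : ∀ k, k ∉ J.vars → m k = 0)
    (h1 : ∀ k, k ∈ J.vars → k ∉ I.vars → 0 < m k) :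
    Set.range ((charts n).map (homOfLE h).op) =
      (PrimeSpectrum.basicOpen (⟨mon m, Chart.mon_mem n hm⟩ : I.ring n) :
        Set (PrimeSpectrum (I.ring n))) := by
  let _ := (Chart.res n h).toAlgebra
  have := Chart.isLocalization n h m hm h0 h1
  exact PrimeSpectrum.localization_away_comap_range (J.ring n)
    (⟨mon m, Chart.mon_mem n hm⟩ : I.ring n)

instance (n : ℕ) {I J : Chartᵒᵖ} (f : I ⟶ J) : IsOpenImmersion ((charts n).map f) := by
  have h : J.unop ≤ I.unop := leOfHom f.unop
  let _ := (Chart.res n h).toAlgebra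
  have := Chart.isLocalization n h _ (Chart.locus_mem n J.unop I.unop)
    (fun k hk => by rw [Chart.locus_apply n _ _ fun hk' => hk (h hk'), if_neg hk])
    (fun k hk hk' => by rw [Chart.locus_apply n _ _ hk', if_pos hk]; exact one_pos)
  exact IsOpenImmersion.of_isLocalization (R := J.unop.ring n) (S := I.unop.ring n)
    ⟨mon (Chart.locus n J.unop I.unop), Chart.mon_mem n (Chart.locus_mem n J.unop I.unop)⟩

instance (n : ℕ) : (charts n ⋙ Scheme.forget).IsLocallyDirected where
  cond {I₁ I₂ I} f₁ f₂ x₁ x₂ hx := by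
    obtain ⟨J₁, rfl⟩ := op_surjective I₁
    obtain ⟨J₂, rfl⟩ := op_surjective I₂
    obtain ⟨J, rfl⟩ := op_surjective I
    have h₁ : J ≤ J₁ := leOfHom f₁.unop
    have h₂ : J ≤ J₂ := leOfHom f₂.unop
    let J₃ : Chart := ⟨J₁.vars ∪ J₂.vars, J₁.base.imp (Finset.mem_union_left _)
      (Finset.mem_union_left _), J₁.fibre.imp (Finset.mem_union_left _) (Finset.mem_union_left _)⟩
    have h₁₃ : J₁ ≤ J₃ := Finset.subset_union_left
    have h₂₃ : J₂ ≤ J₃ := Finset.subset_union_right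
    have h₃ : J ≤ J₃ := h₁.trans h₁₃
    have hl (J' : Chart) (h : J ≤ J') := charts_map_range n h _ (Chart.locus_mem n J J')
      (fun k hk => by rw [Chart.locus_apply n _ _ fun hk' => hk (h hk'), if_neg hk])
      (fun k hk hk' => by rw [Chart.locus_apply n _ _ hk', if_pos hk]; exact one_pos)
    have hm : Chart.locus n J J₁ + Chart.locus n J J₂ ∈ J.exps n :=
      ⟨by rw [deg_add, Chart.deg_locus, Chart.deg_locus, add_zero], fun k hk =>
        add_nonneg ((Chart.locus_mem n J J₁).2 k hk) ((Chart.locus_mem n J J₂).2 k hk)⟩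
    have hl₃ := charts_map_range n h₃ _ hm
      (fun k hk => by
        have hk' : k ∉ J₁.vars ∧ k ∉ J₂.vars := by simpa [J₃] using hk
        have hk'' : k ∉ J.vars := fun h => hk (h₃ h)
        rw [Pi.add_apply, Chart.locus_apply n _ _ hk'', Chart.locus_apply n _ _ hk'',
          if_neg hk'.1, if_neg hk'.2, add_zero])
      (fun k hk hk' => by
        have hk'' : k ∈ J₁.vars ∨ k ∈ J₂.vars := by simpa [J₃] using hk
        rw [Pi.add_apply, Chart.locus_apply n _ _ hk', Chart.locus_apply n _ _ hk']
        rcases hk'' with h | h <;> rw [if_pos h] <;> split_ifs <;> norm_num)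
    let x : (charts n).obj (op J) := (charts n).map f₁ x₁
    have hx₁ : x = (charts n).map f₁ x₁ := rfl
    have hx₂ : x = (charts n).map f₂ x₂ := hx
    have hmem : x ∈ Set.range ((charts n).map (homOfLE h₃).op) := by
      rw [hl₃]
      have e₁ : x ∈ Set.range ((charts n).map (homOfLE h₁).op) := ⟨x₁, rfl⟩
      have e₂ : x ∈ Set.range ((charts n).map (homOfLE h₂).op) := ⟨x₂, hx₂.symm⟩
      rw [hl] at e₁ e₂
      have : (⟨mon (Chart.locus n J J₁ + Chart.locus n J J₂), Chart.mon_mem n hm⟩ : J.ring n) =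
          ⟨mon (Chart.locus n J J₁), Chart.mon_mem n (Chart.locus_mem n J J₁)⟩ *
            ⟨mon (Chart.locus n J J₂), Chart.mon_mem n (Chart.locus_mem n J J₂)⟩ :=
        Subtype.ext (mon_add _ _)
      rw [this, PrimeSpectrum.basicOpen_mul]
      exact ⟨e₁, e₂⟩
    obtain ⟨z, hz⟩ := hmem
    refine ⟨op J₃, (homOfLE h₁₃).op, (homOfLE h₂₃).op, z, ?_, ?_⟩
    · apply ((charts n).map f₁).injective
      change (charts n).map f₁ ((charts n).map (homOfLE h₁₃).op z) = _
      rw [← Scheme.Hom.comp_apply, ← Functor.map_comp]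
      exact hz
    · apply ((charts n).map f₂).injective
      change (charts n).map f₂ ((charts n).map (homOfLE h₂₃).op z) = _
      rw [← Scheme.Hom.comp_apply, ← Functor.map_comp]
      exact hz.trans hx₂

/-- The Hirzebruch surface `Σ_n` over `ℂ`, glued from its affine charts. It is the surface
`{x₁ y₁ ^ n = x₂ y₂ ^ n}` in `ℙ² × ℙ¹`, with `x₁ = y₂ ^ n s`, `x₂ = y₁ ^ n s`, `x₃ = t`. The fibre of
the projection to `ℙ¹` has class `𝔣`; `s = 0` is the exceptional section, of class
`𝔢 = 𝔥 - n 𝔣`, and `𝔥` is the class of a line in `ℙ²`. -/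
def surface (n : ℕ) : Scheme.{0} := colimit (charts n)

/-- The inclusion of a chart. -/
def ι (n : ℕ) (I : Chart) : (charts n).obj (op I) ⟶ surface n := colimit.ι (charts n) (op I)

instance (n : ℕ) (I : Chart) : IsOpenImmersion (ι n I) :=
  inferInstanceAs (IsOpenImmersion (colimit.ι (charts n) (op I)))

lemma charts_map_ι (n : ℕ) {I J : Chart} (h : I ≤ J) :
    (charts n).map (homOfLE h).op ≫ ι n I = ι n J :=
  colimit.w (charts n) (homOfLE h).op

/-! ### The sheaves `𝒪(a, b)` -/

/-- An element of a ring `R` as a function on an open subset of `Spec R`. -/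
def toSpec (R : CommRingCat.{0}) (U : (Spec R).Opens) : R ⟶ Γ(Spec R, U) :=
  (Scheme.ΓSpecIso R).inv ≫ (Spec R).presheaf.map (homOfLE le_top).op

lemma toSpec_map (R : CommRingCat.{0}) {U V : (Spec R).Opens} (h : op U ⟶ op V) :
    toSpec R U ≫ (Spec R).presheaf.map h = toSpec R V := by
  unfold toSpec
  rw [Category.assoc, ← Functor.map_comp]
  rfl

lemma toSpec_appLE {R S : CommRingCat.{0}} (f : R ⟶ S) (U : (Spec R).Opens) (V : (Spec S).Opens)
    (e : V ≤ Spec.map f ⁻¹ᵁ U) :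
    toSpec R U ≫ (Spec.map f).appLE U V e = f ≫ toSpec S V := by
  unfold toSpec
  rw [Category.assoc, Scheme.Hom.map_appLE, Scheme.ΓSpecIso_inv_naturality_assoc]
  rfl

/-- The functions on the part of `W` that lies in the chart `I`. -/
abbrev Chart.functions (n : ℕ) (I : Chart) (W : (surface n).Opens) : CommRingCat.{0} :=
  Γ((charts n).obj (op I), ι n I ⁻¹ᵁ W)

/-- An element of the coordinate ring of a chart as a function on the part of `W` in the chart. -/
def Chart.toFunctions (n : ℕ) (I : Chart) (W : (surface n).Opens) :
    I.ring n →+* I.functions n W :=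
  (toSpec (CommRingCat.of (I.ring n)) (ι n I ⁻¹ᵁ W)).hom

lemma Chart.preimage_le (n : ℕ) {I J : Chart} (h : I ≤ J) (W : (surface n).Opens) :
    ι n J ⁻¹ᵁ W ≤ (charts n).map (homOfLE h).op ⁻¹ᵁ ι n I ⁻¹ᵁ W := by
  rw [← Scheme.Hom.comp_preimage, charts_map_ι]

/-- The restriction of functions on `W` from a chart to a smaller chart. -/
def Chart.restrict (n : ℕ) {I J : Chart} (h : I ≤ J) (W : (surface n).Opens) :
    I.functions n W ⟶ J.functions n W :=
  ((charts n).map (homOfLE h).op).appLE (ι n I ⁻¹ᵁ W) (ι n J ⁻¹ᵁ W)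
    (Chart.preimage_le n h W)

/-- The restriction of functions on a chart to a smaller open set. -/
def Chart.shrink (n : ℕ) (I : Chart) {W W' : (surface n).Opens} (h : W' ≤ W) :
    I.functions n W ⟶ I.functions n W' :=
  ((charts n).obj (op I)).presheaf.map ((Opens.map (ι n I).base).map (homOfLE h)).op

lemma Chart.shrink_restrict (n : ℕ) {I J : Chart} (h : I ≤ J) {W W' : (surface n).Opens}
    (hW : W' ≤ W) (s : I.functions n W) :
    J.shrink n hW (Chart.restrict n h W s) = Chart.restrict n h W' (I.shrink n hW s) := by
  unfold Chart.shrink Chart.restrict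
  rw [← CommRingCat.comp_apply, ← CommRingCat.comp_apply, Scheme.Hom.appLE_map,
    Scheme.Hom.map_appLE]

lemma Chart.shrink_toFunctions (n : ℕ) (I : Chart) {W W' : (surface n).Opens}
    (hW : W' ≤ W) (a : I.ring n) :
    I.shrink n hW (I.toFunctions n W a) = I.toFunctions n W' a := by
  exact congr($(toSpec_map (CommRingCat.of (I.ring n))
    ((Opens.map (ι n I).base).map (homOfLE hW)).op).hom a)

lemma Chart.restrict_toFunctions (n : ℕ) {I J : Chart} (h : I ≤ J) (W : (surface n).Opens)
    (a : I.ring n) :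
    Chart.restrict n h W (I.toFunctions n W a) = J.toFunctions n W (Chart.res n h a) := by
  exact congr($(toSpec_appLE (CommRingCat.ofHom (Chart.res n h)) (ι n I ⁻¹ᵁ W) (ι n J ⁻¹ᵁ W)
    (Chart.preimage_le n h W)).hom a)

lemma Chart.restrict_app (n : ℕ) {I J : Chart} (h : I ≤ J) (W : (surface n).Opens)
    (r : Γ(surface n, W)) :
    Chart.restrict n h W ((ι n I).app W r) = (ι n J).app W r := by
  unfold Chart.restrict
  rw [← CommRingCat.comp_apply, Scheme.Hom.app_eq_appLE, Scheme.Hom.appLE_comp_appLE]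
  simp only [charts_map_ι, Scheme.Hom.appLE_eq_app]

lemma Chart.shrink_app (n : ℕ) (I : Chart) {W W' : (surface n).Opens} (hW : W' ≤ W)
    (r : Γ(surface n, W)) :
    I.shrink n hW ((ι n I).app W r) =
      (ι n I).app W' ((surface n).presheaf.map (homOfLE hW).op r) := by
  unfold Chart.shrink
  rw [← CommRingCat.comp_apply, ← CommRingCat.comp_apply, Scheme.Hom.naturality]
  rfl

/-- The sections of `𝒪(a, b)` over `W`: a function on every chart, in terms of the chosen
generator of `𝒪(a, b)` on that chart, such that these functions are compatible with the
transition functions. -/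
def sections (n : ℕ) (d : ℤ × ℤ) (W : (surface n).Opens) :
    AddSubgroup (∀ I : Chart, I.functions n W) where
  carrier := {s | ∀ (I J : Chart) (h : I ≤ J),
    s J = J.toFunctions n W (Chart.transition n h d) * Chart.restrict n h W (s I)}
  zero_mem' I J h := by simp
  add_mem' {s s'} hs hs' I J h := by
    rw [Pi.add_apply, Pi.add_apply, map_add, mul_add, ← hs I J h, ← hs' I J h]
  neg_mem' {s} hs I J h := by
    rw [Pi.neg_apply, Pi.neg_apply, map_neg, mul_neg, ← hs I J h]

instance (n : ℕ) (d : ℤ × ℤ) (W : (surface n).Opens) :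
    Module Γ(surface n, W) (sections n d W) where
  smul r s := ⟨fun I => (ι n I).app W r * s.1 I, fun I J h => by
    rw [map_mul, Chart.restrict_app, mul_left_comm, ← s.2 I J h]⟩
  one_smul s := Subtype.ext <| funext fun I => by
    change (ι n I).app W 1 * s.1 I = s.1 I
    rw [map_one, one_mul]
  mul_smul r r' s := Subtype.ext <| funext fun I => by
    change (ι n I).app W (r * r') * s.1 I = (ι n I).app W r * ((ι n I).app W r' * s.1 I)
    rw [map_mul, mul_assoc]
  smul_zero r := Subtype.ext <| funext fun I => mul_zero _
  smul_add r s s' := Subtype.ext <| funext fun I => mul_add _ _ _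
  add_smul r r' s := Subtype.ext <| funext fun I => by
    change (ι n I).app W (r + r') * s.1 I = (ι n I).app W r * s.1 I + (ι n I).app W r' * s.1 I
    rw [map_add, add_mul]
  zero_smul s := Subtype.ext <| funext fun I => by
    change (ι n I).app W 0 * s.1 I = 0
    rw [map_zero, zero_mul]

/-- The restriction maps of `𝒪(a, b)`. -/
def sectionsMap (n : ℕ) (d : ℤ × ℤ) {W W' : (surface n).Opens} (hW : W' ≤ W) :
    sections n d W →+ sections n d W' where
  toFun s := ⟨fun I => I.shrink n hW (s.1 I), fun I J h => by
    dsimp only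
    rw [s.2 I J h, map_mul, Chart.shrink_toFunctions, Chart.shrink_restrict]⟩
  map_zero' := Subtype.ext <| funext fun I => map_zero _
  map_add' s s' := Subtype.ext <| funext fun I => map_add _ _ _

/-- The underlying presheaf of abelian groups of `𝒪(a, b)`. -/
def sectionsPresheaf (n : ℕ) (d : ℤ × ℤ) : TopCat.Presheaf Ab.{0} (surface n) where
  obj W := AddCommGrpCat.of (sections n d W.unop)
  map f := AddCommGrpCat.ofHom (sectionsMap n d (leOfHom f.unop))
  map_id W := by
    refine AddCommGrpCat.hom_ext <| AddMonoidHom.ext fun s => ?_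
    refine Subtype.ext ?_
    funext I
    change ((charts n).obj (op I)).presheaf.map (𝟙 _) (s.1 I) = s.1 I
    rw [CategoryTheory.Functor.map_id]
    rfl
  map_comp f g := by
    refine AddCommGrpCat.hom_ext <| AddMonoidHom.ext fun s => ?_
    refine Subtype.ext ?_
    funext I
    change _ = ((charts n).obj (op I)).presheaf.map _
      (((charts n).obj (op I)).presheaf.map _ (s.1 I))
    rw [← CommRingCat.comp_apply, ← Functor.map_comp]
    rfl

lemma sectionsPresheaf_isSheaf (n : ℕ) (d : ℤ × ℤ) : (sectionsPresheaf n d).IsSheaf := by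
  rw [TopCat.Presheaf.isSheaf_iff_isSheafUniqueGluing]
  intro κ U sf hsf
  have hU (i : κ) : U i ≤ iSup U := le_iSup U i
  have hcov (I : Chart) : ι n I ⁻¹ᵁ iSup U ≤ ⨆ i, ι n I ⁻¹ᵁ U i := by
    rw [Scheme.Hom.preimage_iSup]
  have hex (I : Chart) : ∃! s : I.functions n (iSup U),
      ∀ i, I.shrink n (hU i) s = (sf i).1 I :=
    ((charts n).obj (op I)).sheaf.existsUnique_gluing'
      (fun i => ι n I ⁻¹ᵁ U i) (ι n I ⁻¹ᵁ iSup U)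
      (fun i => (Opens.map (ι n I).base).map (homOfLE (hU i))) (hcov I)
      (fun i => (sf i).1 I) (fun i j => congrFun (congrArg Subtype.val (hsf i j)) I)
  choose s hs hs' using hex
  dsimp only at hs hs'
  have hcompat : s ∈ sections n d (iSup U) := fun I J h => by
    refine ((charts n).obj (op J)).sheaf.eq_of_locally_eq' (fun i => ι n J ⁻¹ᵁ U i)
      (ι n J ⁻¹ᵁ iSup U) (fun i => (Opens.map (ι n J).base).map (homOfLE (hU i))) (hcov J)
      _ _ fun i => ?_
    change J.shrink n (hU i) (s J) = J.shrink n (hU i) _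
    rw [map_mul, Chart.shrink_toFunctions, Chart.shrink_restrict, hs, hs, ← (sf i).2 I J h]
  refine ⟨⟨s, hcompat⟩, fun i => Subtype.ext (funext fun I => hs I i), fun s' h' => ?_⟩
  refine Subtype.ext (funext fun I => hs' I _ fun i => ?_)
  exact congrFun (congrArg Subtype.val (h' i)) I

instance (n : ℕ) (d : ℤ × ℤ) (W : (Opens (surface n))ᵒᵖ) :
    Module ((surface n).ringCatSheaf.obj.obj W) ((sectionsPresheaf n d).obj W) :=
  inferInstanceAs (Module Γ(surface n, W.unop) (sections n d W.unop))

/-- The invertible sheaf `𝒪(a, b) = 𝒪(a 𝔥 + b 𝔣)`. -/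
def O (n : ℕ) (d : ℤ × ℤ) : (surface n).Modules where
  val := PresheafOfModules.ofPresheaf (sectionsPresheaf n d) fun W W' f r s =>
    Subtype.ext <| funext fun I => by
      change I.shrink n (leOfHom f.unop) ((ι n I).app W.unop r * s.1 I) = _
      rw [map_mul]
      exact congrArg (· * _) (Chart.shrink_app n I (leOfHom f.unop) r)
  isSheaf := sectionsPresheaf_isSheaf n d

/-- Multiplication by a global section `f` of `𝒪(a', b')`, on the sections over `W`. -/
def mulSections (n : ℕ) {c d d' : ℤ × ℤ} (f : GlobalSections n c) (h : d + c = d')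
    (W : (surface n).Opens) : sections n d W →+ sections n d' W where
  toFun s := ⟨fun I => I.toFunctions n W (I.local n f) * s.1 I, fun I J hIJ => by
    dsimp only
    rw [s.2 I J hIJ, map_mul, Chart.restrict_toFunctions, ← mul_assoc, ← mul_assoc, ← map_mul,
      ← map_mul]
    congr 2
    refine Subtype.ext ?_
    change algebraMap Cox CoxField f / mon (J.gen n c) * mon (I.gen n d - J.gen n d) =
      mon (I.gen n d' - J.gen n d') * (algebraMap Cox CoxField f / mon (I.gen n c))
    subst h
    rw [Chart.gen_add, Chart.gen_add, mon_sub, mon_sub, mon_add, mon_add]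
    have h1 := mon_ne_zero (I.gen n c)
    have h2 := mon_ne_zero (J.gen n c)
    have h3 := mon_ne_zero (J.gen n d)
    field_simp⟩
  map_zero' := Subtype.ext <| funext fun I => mul_zero _
  map_add' s s' := Subtype.ext <| funext fun I => mul_add _ _ _

/-- Multiplication by a global section `f` of `𝒪(a', b')`, as a morphism
`𝒪(a, b) ⟶ 𝒪(a + a', b + b')`. -/
def mul (n : ℕ) {c d d' : ℤ × ℤ} (f : GlobalSections n c) (h : d + c = d') :
    O n d ⟶ O n d' where
  val := PresheafOfModules.homMk
    { app W := AddCommGrpCat.ofHom (mulSections n f h W.unop)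
      naturality W W' g := by
        refine AddCommGrpCat.hom_ext <| AddMonoidHom.ext fun s => ?_
        refine Subtype.ext ?_
        funext I
        change I.toFunctions n W'.unop (I.local n f) * I.shrink n (leOfHom g.unop) (s.1 I) =
          I.shrink n (leOfHom g.unop) (I.toFunctions n W.unop (I.local n f) * s.1 I)
        rw [map_mul, Chart.shrink_toFunctions] }
    fun W r s => Subtype.ext <| funext fun I => mul_left_comm _ _ _

/-! ### The sheaves `V' ⊗ 𝒪(a, b)` -/

/-- The product of global sections of `𝒪(a, b)` and `𝒪(a', b')`. -/
def gmul {n : ℕ} {e e' : ℤ × ℤ} (f : GlobalSections n e) (g : GlobalSections n e') :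
    GlobalSections n (e + e') :=
  ⟨f.1 * g.1, MvPolynomial.IsWeightedHomogeneous.mul f.2 g.2⟩

lemma mul_ext {n : ℕ} {d d' : ℤ × ℤ} {φ ψ : O n d ⟶ O n d'}
    (h : ∀ (W : (surface n).Opens) (s : sections n d W) (I : Chart),
      (φ.val.app (op W) s : sections n d' W).1 I = (ψ.val.app (op W) s : sections n d' W).1 I) :
    φ = ψ := by
  refine SheafOfModules.hom_ext (PresheafOfModules.hom_ext fun W => ?_)
  refine ModuleCat.hom_ext (LinearMap.ext fun s => ?_)
  exact Subtype.ext (funext fun I => h W.unop s I)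

lemma mul_comp (n : ℕ) {e e' d d' d'' : ℤ × ℤ} (f : GlobalSections n e) (g : GlobalSections n e')
    (h : d + e = d') (h' : d' + e' = d'') :
    mul n f h ≫ mul n g h' = mul n (gmul f g) (by rw [← h', ← h, add_assoc]) := by
  refine mul_ext fun W s I => ?_
  change I.toFunctions n W (I.local n g) * (I.toFunctions n W (I.local n f) * s.1 I) =
    I.toFunctions n W (I.local n (gmul f g)) * s.1 I
  rw [← mul_assoc, ← map_mul]
  congr 2
  refine Subtype.ext ?_
  change algebraMap Cox CoxField g / mon (I.gen n e') * (algebraMap Cox CoxField f / mon (I.gen n e))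
    = algebraMap Cox CoxField (f.1 * g.1) / mon (I.gen n (e + e'))
  rw [Chart.gen_add, mon_add, map_mul, div_mul_div_comm, mul_comm, mul_comm (mon _)]

lemma mul_congr (n : ℕ) {e e' d d' : ℤ × ℤ} {f : GlobalSections n e} {g : GlobalSections n e'}
    (he : e = e') (hfg : f.1 = g.1) (h : d + e = d') (h' : d + e' = d') :
    mul n f h = mul n g h' := by
  subst he
  rw [Subtype.ext hfg]

lemma mul_add' (n : ℕ) {e d d' : ℤ × ℤ} (f g : GlobalSections n e) (h : d + e = d') :
    mul n (f + g) h = mul n f h + mul n g h := by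
  refine mul_ext fun W s I => ?_
  change I.toFunctions n W (I.local n (f + g)) * s.1 I =
    I.toFunctions n W (I.local n f) * s.1 I + I.toFunctions n W (I.local n g) * s.1 I
  rw [← add_mul, ← map_add]
  congr 2
  refine Subtype.ext ?_
  change algebraMap Cox CoxField (f.1 + g.1) / _ = algebraMap Cox CoxField f / _ +
    algebraMap Cox CoxField g / _
  rw [map_add, add_div]

lemma mul_sum' (n : ℕ) {e d d' : ℤ × ℤ} {κ : Type*} (S : Finset κ) (f : κ → GlobalSections n e)
    (h : d + e = d') : mul n (∑ k ∈ S, f k) h = ∑ k ∈ S, mul n (f k) h :=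
  map_sum (AddMonoidHom.mk' (fun f => mul n f h) fun f g => mul_add' n f g h) f S

instance (n : ℕ) : HasFiniteBiproducts (surface n).Modules :=
  HasFiniteBiproducts.of_hasFiniteProducts

/-- The sheaf `V' ⊗ 𝒪(a, b)`, for a vector space `V'` of dimension `c`, written with the help of a
basis of `V'` as the direct sum of `c` copies of `𝒪(a, b)`. -/
def tensorO (n c : ℕ) (d : ℤ × ℤ) : (surface n).Modules := ⨁ fun _ : Fin c => O n d

/-- The morphism `A ⊗ f : V' ⊗ 𝒪(a, b) ⟶ V' ⊗ 𝒪(a + a', b + b')` given by an endomorphism `A` of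
`V'` and a global section `f` of `𝒪(a', b')`. In the basis `B` it is the matrix of `A`, multiplied by `f`. -/
def tensorMap (n : ℕ) {c : ℕ} {V' : Type*} [AddCommGroup V'] [Module ℂ V']
    (B : Module.Basis (Fin c) ℂ V') (A : Module.End ℂ V') {e d d' : ℤ × ℤ}
    (f : GlobalSections n e) (h : d + e = d') : tensorO n c d ⟶ tensorO n c d' :=
  biproduct.matrix fun j i => mul n (LinearMap.toMatrix B B A i j • f) h

lemma tensorMap_comp (n : ℕ) {c : ℕ} {V' : Type*} [AddCommGroup V'] [Module ℂ V']
    (B : Module.Basis (Fin c) ℂ V') (A A' : Module.End ℂ V') {e e' d d' d'' : ℤ × ℤ}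
    (f : GlobalSections n e) (g : GlobalSections n e') (h : d + e = d') (h' : d' + e' = d'') :
    tensorMap n B A f h ≫ tensorMap n B A' g h' =
      tensorMap n B (A' * A) (gmul f g) (by rw [← h', ← h, add_assoc]) := by
  unfold tensorMap tensorO
  refine biproduct.hom_ext' _ _ fun j => biproduct.hom_ext _ _ fun i => ?_
  simp only [Category.assoc, biproduct.matrix_π, biproduct.ι_matrix_assoc,
    biproduct.ι_matrix, biproduct.lift_desc, biproduct.lift_π, mul_comp]
  rw [← mul_sum']
  congr 1
  rw [LinearMap.toMatrix_mul, Matrix.mul_apply, Finset.sum_smul]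
  refine Finset.sum_congr rfl fun k _ => Subtype.ext ?_
  simp only [gmul, Submodule.coe_smul, Algebra.smul_mul_assoc,
    Algebra.mul_smul_comm, smul_smul]

lemma tensorMap_comm (n : ℕ) {c : ℕ} {V' : Type*} [AddCommGroup V'] [Module ℂ V']
    (B : Module.Basis (Fin c) ℂ V') {A A' : Module.End ℂ V'} (hA : Commute A A')
    {e e' d d₁ d₂ d₃ : ℤ × ℤ} (f : GlobalSections n e) (g : GlobalSections n e')
    (h₁ : d + e = d₁) (h₁' : d₁ + e' = d₃) (h₂ : d + e' = d₂) (h₂' : d₂ + e = d₃) :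
    tensorMap n B A f h₁ ≫ tensorMap n B A' g h₁' =
      tensorMap n B A' g h₂ ≫ tensorMap n B A f h₂' := by
  rw [tensorMap_comp, tensorMap_comp, hA.eq]
  refine congrArg biproduct.matrix (funext fun j => funext fun i => ?_)
  refine mul_congr n (add_comm e e') ?_ _ _
  exact congrArg (_ • ·) (mul_comm f.1 g.1)

/-! ### The complex -/

/-- The complex `0 ⟶ A ⟶ B ⟶ C ⟶ 0` with `A`, `B`, `C` in degrees `-1`, `0`, `1`. -/
def threeTerm {𝒞 : Type*} [Category 𝒞] [HasZeroMorphisms 𝒞] [HasZeroObject 𝒞] {A B C : 𝒞}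
    (α : A ⟶ B) (β : B ⟶ C) (w : α ≫ β = 0) : CochainComplex 𝒞 ℤ :=
  open scoped ZeroObject in
  let X : ℤ → 𝒞 := fun
    | -1 => A
    | 0 => B
    | 1 => C
    | _ => 0
  let d : ∀ i j, X i ⟶ X j := fun
    | -1, 0 => α
    | 0, 1 => β
    | _, _ => 0
  have hd : ∀ i j, ¬ (i = -1 ∧ j = 0) → ¬ (i = 0 ∧ j = 1) → d i j = 0 := by
    intro i j h h'
    dsimp only [d]
    split
    · simp at h
    · simp at h'
    · rfl
  { X := X
    d := d
    shape := fun i j h => by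
      change ¬ i + 1 = j at h
      exact hd i j (by omega) (by omega)
    d_comp_d' := fun i j k h h' => by
      change i + 1 = j at h
      change j + 1 = k at h'
      by_cases hi : i = -1
      · obtain rfl : j = 0 := by omega
        obtain rfl : k = 1 := by omega
        subst hi
        exact w
      · by_cases hi' : i = 0
        · rw [hd j k (by omega) (by omega), comp_zero]
        · rw [hd i j (by omega) (by omega), zero_comp] }

/-- The product `y ^ n * s` of the `n`-th power of a section `y` of `𝒪(0, 1)` with a section `s` of
`𝒪(1, -n)`, as a section of `𝒪(1, 0)`. -/
def powMul {n : ℕ} (y : GlobalSections n (0, 1)) (s : GlobalSections n (1, -(n : ℤ))) :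
    GlobalSections n (1, 0) :=
  ⟨y.1 ^ n * s.1, by
    have h := MvPolynomial.IsWeightedHomogeneous.mul
      (MvPolynomial.IsWeightedHomogeneous.pow y.2 n) s.2
    have e : n • ((0, 1) : ℤ × ℤ) + (1, -(n : ℤ)) = (1, 0) := by ext <;> simp
    rw [e] at h
    exact h⟩

/-- The morphism `A ⊗ f + A' ⊗ g`, for endomorphisms `A`, `A'` of `V'` and global sections `f`, `g`
of `𝒪(a', b')`. -/
def pencil {n c : ℕ} {V' : Type*} [AddCommGroup V'] [Module ℂ V']
    (B : Module.Basis (Fin c) ℂ V') (A A' : Module.End ℂ V') {e : ℤ × ℤ}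
    (f g : GlobalSections n e) {d d' : ℤ × ℤ} (h : d + e = d') : tensorO n c d ⟶ tensorO n c d' :=
  tensorMap n B A f h + tensorMap n B A' g h

lemma pencil_comm {n c : ℕ} {V' : Type*} [AddCommGroup V'] [Module ℂ V']
    (B : Module.Basis (Fin c) ℂ V') {b b' : Module.End ℂ V'} (hb : Commute b b')
    {e e' d d₁ d₂ d₃ : ℤ × ℤ}
    (f g : GlobalSections n e) (f' g' : GlobalSections n e')
    (h₁ : d + e = d₁) (h₁' : d₁ + e' = d₃) (h₂ : d + e' = d₂) (h₂' : d₂ + e = d₃) :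
    pencil B 1 b f g h₁ ≫ pencil B 1 b' f' g' h₁' = pencil B 1 b' f' g' h₂ ≫ pencil B 1 b f g h₂' := by
  unfold pencil
  simp only [Preadditive.comp_add, Preadditive.add_comp]
  rw [tensorMap_comm n B (Commute.one_left 1) f f' h₁ h₁' h₂ h₂',
    tensorMap_comm n B (Commute.one_right b) g f' h₁ h₁' h₂ h₂',
    tensorMap_comm n B (Commute.one_left b') f g' h₁ h₁' h₂ h₂',
    tensorMap_comm n B hb g g' h₁ h₁' h₂ h₂']
  abel

section

variable {n c : ℕ} {V : Type*} [AddCommGroup V] [Module ℂ V] (B : Module.Basis (Fin c) ℂ V)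
  (b₁ b₂ : Module.End ℂ V) (y₁ y₂ : GlobalSections n (0, 1))
  (sE : GlobalSections n (1, -(n : ℤ))) (sInf : GlobalSections n (1, 0))

/-- The morphism `α = (id ⊗ y₂ ^ n s_e + b₂* ⊗ s_∞, id ⊗ y₁ + b₁* ⊗ y₂)` from `V* ⊗ 𝒪(0, -1)` to
`V* ⊗ (𝒪(1, -1) ⊕ 𝒪)`. -/
def alpha : tensorO n c (0, -1) ⟶ tensorO n c (1, -1) ⊞ tensorO n c (0, 0) :=
  biprod.lift
    (pencil B.dualBasis 1 b₂.dualMap (powMul y₂ sE) sInf (by simp))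
    (pencil B.dualBasis 1 b₁.dualMap y₁ y₂ (by simp))

/-- The morphism `β = (id ⊗ y₁ + b₁* ⊗ y₂, -(id ⊗ y₂ ^ n s_e + b₂* ⊗ s_∞))` from
`V* ⊗ (𝒪(1, -1) ⊕ 𝒪)` to `V* ⊗ 𝒪(1, 0)`. -/
def beta : tensorO n c (1, -1) ⊞ tensorO n c (0, 0) ⟶ tensorO n c (1, 0) :=
  biprod.desc
    (pencil B.dualBasis 1 b₁.dualMap y₁ y₂ (by simp))
    (-pencil B.dualBasis 1 b₂.dualMap (powMul y₂ sE) sInf (by simp))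

lemma alpha_beta (hb : Commute b₁ b₂) :
    alpha B b₁ b₂ y₁ y₂ sE sInf ≫ beta B b₁ b₂ y₁ y₂ sE sInf = 0 := by
  have hb' : Commute b₂.dualMap b₁.dualMap := by
    refine LinearMap.ext fun f => LinearMap.ext fun v => ?_
    exact congrArg f (LinearMap.congr_fun hb.eq v)
  rw [alpha, beta, biprod.lift_desc, Preadditive.comp_neg,
    pencil_comm B.dualBasis hb' (powMul y₂ sE) sInf y₁ y₂ (d₁ := (1, -1)) (d₂ := (0, 0)) (by simp)
      (by simp) (by simp) (by simp), add_neg_cancel]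

/-- The complex `M(X)`: `V* ⊗ 𝒪(0, -1) ⟶ V* ⊗ (𝒪(1, -1) ⊕ 𝒪) ⟶ V* ⊗ 𝒪(1, 0)` with the maps `α`
and `β`, in degrees `-1`, `0`, `1`. -/
def complexM (hb : Commute b₁ b₂) : CochainComplex (surface n).Modules ℤ :=
  threeTerm (alpha B b₁ b₂ y₁ y₂ sE sInf) (beta B b₁ b₂ y₁ y₂ sE sInf)
    (alpha_beta B b₁ b₂ y₁ y₂ sE sInf hb)

end

end Hirzebruch

end

/-!
On `V* ⊗ 𝒪(a, b)` the complex is the Koszul complex of two commuting square matrices of sections,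
`Q = y₁ + b₁* y₂` and `P = y₂ ^ n s_e + b₂* s_∞`, so it is exact in degrees `-1` and `0` as soon as
`Q` is injective and `P` is injective modulo `Q`. Both follow from statements about determinants.

* The determinants of `Q` and `P` are nonzero, respectively coprime to each other, in the Cox ring
  (`isRelPrime_det`). Over `ℂ` the determinant of `Q` is a product of linear forms `y₁ + l y₂`,
  each of which cuts out a fibre on which `y₂` has no zero, and the determinant of `P` is a product
  of sections `y₂ ^ n s_e + m s_∞`. None of the latter vanishes on such a fibre: at its point with
  `s = 0` the section `s_e` vanishes and `s_∞` does not, because `s_∞` is irreducible, so that only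
  `m = 0` would be possible, but `y₂ ^ n s_e` is not zero on the fibre.
* Coprime sections `f`, `g` of line bundles have coprime local equations on every chart
  (`Chart.exists_eq_local_mul`), on every open subset of a chart (`exists_eq_toSpec_mul`), and
  therefore on sections of `𝒪(a, b)` over every open set (`exists_eq_mulSections`). Quotients by `f`
  are unique, which makes them glue. Hence a morphism `y : T ⟶ 𝒪(a, b)` such that `g y` factors
  through multiplication by `f` itself factors through it (`exists_comp_mul_eq_of_isRelPrime`). The
  test object `T` is arbitrary, so no stalks are needed.
* If `Q u = P v`, then `det Q • adj P u = det P • adj Q v`, hence `adj Q v = det Q • z` for some `z`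
  by the previous point applied to each coordinate, and `u = P z`, `v = Q z`
  (`exists_comp_matMap_eq`).
-/

noncomputable section

namespace Hirzebruch

/-! ### Determinants of pencils over a polynomial ring -/

/-- Over a field extension of `ℂ`, the pencil of a complex matrix is singular only at complex
parameters, the eigenvalues being algebraic over `ℂ`. -/
lemma exists_add_mul_eq_zero_of_det_eq_zero {K : Type*} [Field K] [Algebra ℂ K] {c : ℕ}
    (M : Matrix (Fin c) (Fin c) ℂ) (a b : K)
    (h : (Matrix.scalar (Fin c) a + b • M.map (algebraMap ℂ K)).det = 0) :
    ∃ l : ℂ, a + algebraMap ℂ K l * b = 0 := by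
  by_cases hb : b = 0
  · refine ⟨0, ?_⟩
    rw [hb, zero_smul, add_zero, Matrix.scalar_apply, Matrix.det_diagonal, Finset.prod_const] at h
    rw [map_zero, zero_mul, add_zero]
    exact eq_zero_of_pow_eq_zero h
  have e : Matrix.scalar (Fin c) a + b • M.map (algebraMap ℂ K) =
      (-b) • (Matrix.scalar (Fin c) (-(a / b)) - M.map (algebraMap ℂ K)) := by
    ext i j
    simp only [Matrix.add_apply, Matrix.smul_apply, Matrix.sub_apply, Matrix.scalar_apply,
      Matrix.diagonal_apply, smul_eq_mul]
    split_ifs <;> field_simp <;> ring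
  rw [e, Matrix.det_smul] at h
  replace h := (mul_eq_zero.mp h).resolve_left (pow_ne_zero _ (neg_ne_zero.mpr hb))
  have hr : IsIntegral ℂ (-(a / b)) := by
    refine ⟨M.charpoly, M.charpoly_monic, ?_⟩
    rw [← Polynomial.eval_map, ← Matrix.charpoly_map]
    exact (Matrix.eval_charpoly _ _).trans h
  obtain ⟨l, hl⟩ := minpoly.mem_range_of_degree_eq_one ℂ (-(a / b))
    (IsAlgClosed.degree_eq_one_of_irreducible ℂ (minpoly.irreducible hr))
  refine ⟨l, ?_⟩
  rw [hl]
  field_simp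
  ring

/-- The matrix pencil `a • 1 + b • M` over the Cox ring. -/
def pencilMatrix {c : ℕ} (M : Matrix (Fin c) (Fin c) ℂ) (a b : Cox) :
    Matrix (Fin c) (Fin c) Cox :=
  Matrix.scalar (Fin c) a + b • M.map MvPolynomial.C

/-- Over `ℂ` the determinant of a pencil is a product of factors `a + l * b`; this is the part of
that factorization that sees a single prime. -/
lemma exists_dvd_of_prime_dvd_det {c : ℕ} (M : Matrix (Fin c) (Fin c) ℂ) {p a b : Cox}
    (hp : Prime p) (h : p ∣ (pencilMatrix M a b).det) :
    ∃ l : ℂ, p ∣ a + MvPolynomial.C l * b := by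
  have hI : (Ideal.span {p}).IsPrime := (Ideal.span_singleton_prime hp.ne_zero).mpr hp
  let D := Cox ⧸ Ideal.span {p}
  let K := FractionRing D
  let φ : Cox →ₐ[ℂ] K := (IsScalarTower.toAlgHom ℂ D K).comp (Ideal.Quotient.mkₐ ℂ _)
  have hφ (x : Cox) : φ x = 0 ↔ p ∣ x := by
    rw [← Ideal.mem_span_singleton, ← Ideal.Quotient.eq_zero_iff_mem]
    exact (IsFractionRing.injective D K).eq_iff' (map_zero _)
  have hdet : (Matrix.scalar (Fin c) (φ a) + φ b • M.map (algebraMap ℂ K)).det = 0 := by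
    rw [← (hφ _).mpr h, AlgHom.map_det]
    congr 1
    ext i j
    simp only [pencilMatrix, AlgHom.mapMatrix_apply, Matrix.map_apply, Matrix.add_apply,
      Matrix.smul_apply, smul_eq_mul, map_add, map_mul, Matrix.scalar_apply,
      Matrix.diagonal_apply]
    rw [← MvPolynomial.algebraMap_eq, AlgHom.commutes]
    split_ifs <;> simp
  obtain ⟨l, hl⟩ := exists_add_mul_eq_zero_of_det_eq_zero M _ _ hdet
  refine ⟨l, (hφ _).mp ?_⟩
  rw [map_add, map_mul, ← MvPolynomial.algebraMap_eq, AlgHom.commutes, hl]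

/-! ### Sections of low degree -/

lemma weight_wt (n : ℕ) (m : Fin 4 →₀ ℕ) :
    Finsupp.weight (wt n) m = ((m 2 : ℤ) + m 3, (m 0 : ℤ) + m 1 - n * m 2) := by
  rw [← deg_natCast, deg, Fin.sum_univ_four]
  ext
  · simp [wt]
  · simp [wt]
    ring

lemma weight_of_coeff_ne_zero {n : ℕ} {d : ℤ × ℤ} (f : GlobalSections n d) {m : Fin 4 →₀ ℕ}
    (h : f.1.coeff m ≠ 0) :
    (m 2 : ℤ) + m 3 = d.1 ∧ (m 0 : ℤ) + m 1 - n * m 2 = d.2 := by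
  have := f.2 h
  rw [weight_wt] at this
  exact Prod.ext_iff.mp this

/-- The sections of `𝒪(0, 1)` are the linear forms in `y₁, y₂`. -/
lemma exists_eq_linear {n : ℕ} (f : GlobalSections n (0, 1)) :
    ∃ a b : ℂ, f.1 = MvPolynomial.C a * MvPolynomial.X 0 + MvPolynomial.C b * MvPolynomial.X 1 := by
  refine ⟨f.1.coeff (Finsupp.single 0 1), f.1.coeff (Finsupp.single 1 1), ?_⟩
  refine MvPolynomial.ext _ _ fun m => ?_
  rw [MvPolynomial.coeff_add, MvPolynomial.coeff_C_mul, MvPolynomial.coeff_C_mul,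
    MvPolynomial.coeff_X, MvPolynomial.coeff_X]
  have hne : (Finsupp.single (0 : Fin 4) 1 : Fin 4 →₀ ℕ) ≠ Finsupp.single 1 1 := fun h => by
    simpa using DFunLike.congr_fun h 0
  by_cases h : f.1.coeff m = 0
  · rw [h]
    split_ifs with h0 h1 h1
    · exact absurd (h0.trans h1.symm) hne
    · simp [h0, h]
    · simp [h1, h]
    · simp
  · obtain ⟨h1, h2⟩ := weight_of_coeff_ne_zero f h
    have h3 : m 2 = 0 := by omega
    have h4 : m 3 = 0 := by omega
    rw [h3] at h2
    have h5 : m 0 = 1 ∧ m 1 = 0 ∨ m 0 = 0 ∧ m 1 = 1 := by omega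
    rcases h5 with h5 | h5
    · have e : m = Finsupp.single 0 1 := by
        ext k; fin_cases k <;> simp [h3, h4, h5.1, h5.2]
      subst e
      simp [hne.symm]
    · have e : m = Finsupp.single 1 1 := by
        ext k; fin_cases k <;> simp [h3, h4, h5.1, h5.2]
      subst e
      simp [hne]

/-- Up to scalars `s` is the only section of `𝒪(1, -n)`. -/
lemma exists_eq_smul_s {n : ℕ} (hn : 1 ≤ n) (f : GlobalSections n (1, -(n : ℤ))) :
    ∃ k : ℂ, f.1 = MvPolynomial.C k * MvPolynomial.X 2 := by
  refine ⟨f.1.coeff (Finsupp.single 2 1), MvPolynomial.ext _ _ fun m => ?_⟩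
  rw [MvPolynomial.coeff_C_mul, MvPolynomial.coeff_X]
  by_cases h : f.1.coeff m = 0
  · split_ifs with h0
    · rw [h0]; simp
    · simp [h]
  · obtain ⟨h1, h2⟩ := weight_of_coeff_ne_zero f h
    have h3 : m 2 = 0 ∨ m 2 = 1 := by omega
    rcases h3 with h3 | h3
    · rw [h3] at h2
      simp at h2
      omega
    · rw [h3] at h2
      simp at h2
      have e : m = Finsupp.single 2 1 := by
        ext k; fin_cases k <;> simp <;> omega
      subst e
      simp

/-- On the exceptional section `s = 0`, a section of `𝒪(1, 0)` is a multiple of `t`. -/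
lemma exists_eq_t_add_s_mul {n : ℕ} (f : GlobalSections n (1, 0)) :
    ∃ (l : ℂ) (g : Cox), f.1 = MvPolynomial.C l * MvPolynomial.X 3 + MvPolynomial.X 2 * g := by
  refine ⟨f.1.coeff (Finsupp.single 3 1), f.1.divMonomial (Finsupp.single 2 1), ?_⟩
  conv_lhs => rw [← MvPolynomial.modMonomial_add_divMonomial_single f.1 2]
  congr 1
  refine MvPolynomial.ext _ _ fun m => ?_
  rw [MvPolynomial.coeff_C_mul, MvPolynomial.coeff_X]
  by_cases h2 : m 2 = 0
  · rw [MvPolynomial.coeff_modMonomial_of_not_le _ (by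
      rw [Finsupp.single_le_iff]; omega)]
    by_cases h : f.1.coeff m = 0
    · split_ifs with h0
      · rw [h0]; simp
      · simp [h]
    · obtain ⟨h1, h2'⟩ := weight_of_coeff_ne_zero f h
      rw [h2] at h2'
      simp at h1 h2'
      have e : m = Finsupp.single 3 1 := by
        ext k; fin_cases k <;> simp <;> omega
      subst e
      simp
  · rw [MvPolynomial.coeff_modMonomial_of_le _ (by
      rw [Finsupp.single_le_iff]; omega), if_neg, mul_zero]
    rintro rfl
    simp at h2

/-- An irreducible section of `𝒪(1, 0)` is not divisible by `s`, so it does involve `t`. -/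
lemma exists_eq_t_add_s_mul_of_irreducible {n : ℕ} (hn : 1 ≤ n) (f : GlobalSections n (1, 0))
    (hf : Irreducible f.1) :
    ∃ (l : ℂ) (g : Cox), l ≠ 0 ∧
      f.1 = MvPolynomial.C l * MvPolynomial.X 3 + MvPolynomial.X 2 * g := by
  obtain ⟨l, g, h⟩ := exists_eq_t_add_s_mul f
  refine ⟨l, g, ?_, h⟩
  rintro rfl
  rw [map_zero, zero_mul, zero_add] at h
  have hX : ¬ IsUnit (MvPolynomial.X 2 : Cox) := (MvPolynomial.X_prime (i := 2)).not_isUnit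
  have hg : IsUnit g := (hf.isUnit_or_isUnit h).resolve_left hX
  rw [MvPolynomial.isUnit_iff_eq_C_of_isReduced] at hg
  obtain ⟨r, hr, rfl⟩ := hg
  have hw := weight_of_coeff_ne_zero f (m := Finsupp.single 2 1) (by
    rw [h, mul_comm, MvPolynomial.coeff_C_mul, MvPolynomial.coeff_X]
    simpa using hr.ne_zero)
  simp at hw
  omega

lemma irreducible_linear {a b : ℂ} (h : a ≠ 0 ∨ b ≠ 0) :
    Irreducible (MvPolynomial.C a * MvPolynomial.X 0 + MvPolynomial.C b * MvPolynomial.X 1 : Cox) := by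
  have e : (MvPolynomial.C a * MvPolynomial.X 0 + MvPolynomial.C b * MvPolynomial.X 1 : Cox) =
      MvPolynomial.sumSMulX (Finsupp.single 0 a + Finsupp.single 1 b) := by
    rw [map_add]
    simp [MvPolynomial.sumSMulX, MvPolynomial.smul_eq_C_mul]
  have h0 : (Finsupp.single 0 a + Finsupp.single 1 b : Fin 4 →₀ ℂ) 0 = a := by simp
  have h1 : (Finsupp.single 0 a + Finsupp.single 1 b : Fin 4 →₀ ℂ) 1 = b := by simp
  rw [e]
  refine MvPolynomial.irreducible_sumSMulX _ ?_ fun r hr => ?_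
  · rcases h with h | h
    · exact ⟨0, by rwa [Finsupp.mem_support_iff, h0]⟩
    · exact ⟨1, by rwa [Finsupp.mem_support_iff, h1]⟩
  · rw [isUnit_iff_ne_zero]
    rintro rfl
    have e0 := zero_dvd_iff.mp (hr 0)
    have e1 := zero_dvd_iff.mp (hr 1)
    rw [h0] at e0
    rw [h1] at e1
    exact h.elim (· e0) (· e1)

/-- The two pencils have coprime determinants. A common prime factor would be a linear form
`y₁ + l y₂`, that is a fibre, and would divide `y₂ ^ n s_e + m s_∞` for some `m`. But on a fibre
where `y₂ ≠ 0`, the section `s_e` is not a multiple of `s_∞`. -/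
lemma isRelPrime_det {n : ℕ} (hn : 1 ≤ n) {c : ℕ} (M N : Matrix (Fin c) (Fin c) ℂ)
    {y₁ y₂ : GlobalSections n (0, 1)} (hy : LinearIndependent ℂ ![y₁, y₂])
    {sE : GlobalSections n (1, -(n : ℤ))} (hsE : sE ≠ 0)
    {sInf : GlobalSections n (1, 0)} (hsInf : Irreducible (sInf : Cox)) :
    (pencilMatrix M y₁.1 y₂.1).det ≠ 0 ∧
    IsRelPrime (pencilMatrix M y₁.1 y₂.1).det (pencilMatrix N (powMul y₂ sE).1 sInf.1).det := by
  obtain ⟨a₁, b₁, e₁⟩ := exists_eq_linear y₁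
  obtain ⟨a₂, b₂, e₂⟩ := exists_eq_linear y₂
  obtain ⟨k, ek⟩ := exists_eq_smul_s hn sE
  obtain ⟨l, g, hl, el⟩ := exists_eq_t_add_s_mul_of_irreducible hn sInf hsInf
  have hk : k ≠ 0 := by
    rintro rfl
    exact hsE (Subtype.ext (by rw [ek]; simp))
  have hD : a₁ * b₂ - a₂ * b₁ ≠ 0 := by
    intro h0
    have hC : (MvPolynomial.C a₁ * MvPolynomial.C b₂ - MvPolynomial.C a₂ * MvPolynomial.C b₁ : Cox)
        = 0 := by rw [← map_mul, ← map_mul, ← map_sub, h0, map_zero]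
    rw [LinearIndependent.pair_iff] at hy
    have h1 := hy b₂ (-b₁) (Subtype.ext (by
      change b₂ • y₁.1 + (-b₁) • y₂.1 = 0
      rw [e₁, e₂, MvPolynomial.smul_eq_C_mul, MvPolynomial.smul_eq_C_mul]
      rw [map_neg]
      linear_combination MvPolynomial.X 0 * hC))
    have h2 := hy a₂ (-a₁) (Subtype.ext (by
      change a₂ • y₁.1 + (-a₁) • y₂.1 = 0
      rw [e₁, e₂, MvPolynomial.smul_eq_C_mul, MvPolynomial.smul_eq_C_mul]
      rw [map_neg]
      linear_combination (-MvPolynomial.X 1) * hC))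
    have h3 := hy 1 0 (Subtype.ext (by
      change (1 : ℂ) • y₁.1 + (0 : ℂ) • y₂.1 = 0
      rw [e₁, e₂, neg_eq_zero.mp h1.2, neg_eq_zero.mp h2.2]
      simp))
    exact one_ne_zero h3.1
  -- the linear forms `y₁ + u y₂` have the coefficients `a₁ + u a₂`, `b₁ + u b₂`
  have hlin (u : ℂ) : y₁.1 + MvPolynomial.C u * y₂.1 = MvPolynomial.C (a₁ + u * a₂) *
      MvPolynomial.X 0 + MvPolynomial.C (b₁ + u * b₂) * MvPolynomial.X 1 := by
    rw [e₁, e₂]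
    simp only [map_add, map_mul]
    ring
  have hirr (u : ℂ) : Irreducible (y₁.1 + MvPolynomial.C u * y₂.1) := by
    rw [hlin]
    refine irreducible_linear ?_
    by_contra! h
    refine hD ?_
    linear_combination b₂ * h.1 - a₂ * h.2
  have hcop (u v : ℂ) : ¬ y₁.1 + MvPolynomial.C u * y₂.1 ∣
      (powMul y₂ sE).1 + MvPolynomial.C v * sInf.1 := by
    rintro ⟨x, hx⟩
    have hy₂ : a₂ * (b₁ + u * b₂) - b₂ * (a₁ + u * a₂) ≠ 0 := by
      intro h
      refine hD ?_
      linear_combination -h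
    -- evaluation at the point of the fibre `y₁ + u y₂ = 0` with coordinates `s = σ`, `t = τ`
    have hev (σ τ : ℂ) := congrArg
      (MvPolynomial.eval ![b₁ + u * b₂, -(a₁ + u * a₂), σ, τ]) hx
    change ∀ σ τ : ℂ, MvPolynomial.eval _ (y₂.1 ^ n * sE.1 + _) = _ at hev
    rw [hlin, e₂, ek, el] at hev
    simp only [map_add, map_mul, map_pow, MvPolynomial.eval_C, MvPolynomial.eval_X,
      Matrix.cons_val] at hev
    have hv : v = 0 := by
      have h1 := hev 0 1
      have h2 : v * l = 0 := by linear_combination h1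
      exact (mul_eq_zero.mp h2).resolve_right hl
    have h1 := hev 1 0
    have h2 : (a₂ * (b₁ + u * b₂) - b₂ * (a₁ + u * a₂)) ^ n * k = 0 := by
      rw [hv] at h1
      linear_combination h1
    exact (mul_ne_zero (pow_ne_zero _ hy₂) hk) h2
  have hprime {p : Cox} (hp : Prime p) (h1 : p ∣ (pencilMatrix M y₁.1 y₂.1).det)
      (h2 : p ∣ (pencilMatrix N (powMul y₂ sE).1 sInf.1).det) : False := by
    obtain ⟨u, hu⟩ := exists_dvd_of_prime_dvd_det M hp h1
    obtain ⟨v, hv⟩ := exists_dvd_of_prime_dvd_det N hp h2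
    exact hcop u v (((hp.irreducible.dvd_irreducible_iff_associated (hirr u)).mp hu).symm.dvd.trans hv)
  -- a vanishing determinant would be divisible by every prime
  have hQ : (pencilMatrix M y₁.1 y₂.1).det ≠ 0 := fun h => by
    obtain ⟨u, hu⟩ := exists_dvd_of_prime_dvd_det M (p := MvPolynomial.X 2)
      MvPolynomial.X_prime (h ▸ dvd_zero _)
    refine hcop u 0 ((((MvPolynomial.X_prime (i := 2)).irreducible.dvd_irreducible_iff_associated
      (hirr u)).mp hu).symm.dvd.trans ?_)
    change _ ∣ y₂.1 ^ n * sE.1 + _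
    rw [ek, map_zero, zero_mul, add_zero]
    exact ((dvd_refl _).mul_left _).mul_left _
  exact ⟨hQ, WfDvdMonoid.isRelPrime_of_no_irreducible_factors (fun h => hQ h.1)
    fun p hp h1 h2 => hprime hp.prime h1 h2⟩

/-! ### Division in the coordinate rings of the charts -/

/-- A factor of a homogeneous polynomial may be taken homogeneous when the other factor is. -/
lemma exists_homogeneous_factor {n : ℕ} {e D : ℤ × ℤ} (f : GlobalSections n e) (Z : Cox)
    (h : f.1 * Z ∈ GlobalSections n (e + D)) : ∃ Z' : GlobalSections n D, f.1 * Z'.1 = f.1 * Z := by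
  let _ := MvPolynomial.weightedGradedAlgebra ℂ (wt n)
  refine ⟨DirectSum.decompose (MvPolynomial.weightedHomogeneousSubmodule ℂ (wt n)) Z D, ?_⟩
  rw [← DirectSum.coe_decompose_mul_add_of_left_mem _ f.2]
  exact DirectSum.decompose_of_mem_same _ h

/-- The monomial of the Cox ring with the exponents `m`; negative exponents are replaced by `0`. -/
def coxMon (m : Fin 4 → ℤ) : Cox :=
  MvPolynomial.monomial (Finsupp.equivFunOnFinite.symm fun k => (m k).toNat) 1

lemma algebraMap_coxMon {m : Fin 4 → ℤ} (hm : 0 ≤ m) :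
    algebraMap Cox CoxField (coxMon m) = mon m := by
  rw [coxMon, algebraMap_monomial, map_one, one_mul]
  congr 1
  funext k
  simpa using hm k

lemma coxMon_mem (n : ℕ) {m : Fin 4 → ℤ} (hm : 0 ≤ m) : coxMon m ∈ GlobalSections n (deg n m) := by
  refine MvPolynomial.isWeightedHomogeneous_monomial _ _ _ ?_
  rw [← deg_natCast]
  congr 1
  funext k
  simpa using hm k

/-- A fraction of degree zero whose denominator is a monomial in the variables that are invertible
on a chart is a function on that chart. -/
lemma Chart.div_mon_mem (n : ℕ) (I : Chart) {m : Fin 4 → ℤ} (hm : ∀ k, k ∉ I.vars → m k = 0)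
    (F : GlobalSections n (deg n m)) : algebraMap Cox CoxField F / mon m ∈ I.ring n := by
  obtain ⟨f, hf⟩ := F
  rw [MvPolynomial.mem_weightedHomogeneousSubmodule] at hf
  dsimp only
  rw [f.as_sum, map_sum, Finset.sum_div]
  refine Subalgebra.sum_mem _ fun e he => ?_
  rw [algebraMap_monomial, mul_div_assoc, ← mon_sub]
  refine Subalgebra.mul_mem _ (Subalgebra.algebraMap_mem _ _) (Chart.mon_mem n ⟨?_, fun k hk => ?_⟩)
  · rw [deg_sub, deg_natCast, hf (MvPolynomial.mem_support_iff.mp he), sub_self]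
  · rw [Pi.sub_apply, hm k hk, sub_zero]
    exact Int.natCast_nonneg _

/-- Every function on a chart is a fraction as in `Chart.div_mon_mem`. -/
lemma Chart.exists_eq_div_mon (n : ℕ) (I : Chart) {x : CoxField} (hx : x ∈ I.ring n) :
    ∃ (m : Fin 4 → ℤ) (_ : 0 ≤ m) (_ : ∀ k, k ∉ I.vars → m k = 0) (F : GlobalSections n (deg n m)),
      x * mon m = algebraMap Cox CoxField F := by
  unfold Chart.ring at hx
  induction hx using Algebra.adjoin_induction with
  | mem x hx =>
    obtain ⟨e, he, rfl⟩ := hx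
    have h0 : 0 ≤ e + fun k => max (-e k) 0 := fun k => by
      simp only [Pi.add_apply, Pi.zero_apply]; omega
    refine ⟨fun k => max (-e k) 0, fun k => le_max_right _ _, fun k hk => ?_,
      ⟨coxMon (e + fun k => max (-e k) 0), ?_⟩, ?_⟩
    · have := he.2 k hk
      dsimp only
      omega
    · have := coxMon_mem n h0
      rwa [deg_add, he.1, zero_add] at this
    · rw [← mon_add, algebraMap_coxMon h0]
  | algebraMap r =>
    refine ⟨0, le_rfl, fun _ _ => rfl, ⟨MvPolynomial.C r, ?_⟩, ?_⟩
    · have := MvPolynomial.isWeightedHomogeneous_C (wt n) r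
      simpa [deg] using this
    · rw [mon_zero, mul_one, IsScalarTower.algebraMap_apply ℂ Cox CoxField]
      rfl
  | add x y _ _ hx hy =>
    obtain ⟨m, hm, hmI, F, hF⟩ := hx
    obtain ⟨m', hm', hmI', F', hF'⟩ := hy
    refine ⟨m + m', add_nonneg hm hm', fun k hk => by simp [hmI k hk, hmI' k hk],
      ⟨F.1 * coxMon m' + F'.1 * coxMon m, ?_⟩, ?_⟩
    · refine add_mem ?_ ?_
      · rw [deg_add]
        exact MvPolynomial.IsWeightedHomogeneous.mul F.2 (coxMon_mem n hm')
      · rw [deg_add, add_comm]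
        exact MvPolynomial.IsWeightedHomogeneous.mul F'.2 (coxMon_mem n hm)
    · rw [map_add, map_mul, map_mul, ← hF, ← hF', algebraMap_coxMon hm, algebraMap_coxMon hm',
        mon_add]
      ring
  | mul x y _ _ hx hy =>
    obtain ⟨m, hm, hmI, F, hF⟩ := hx
    obtain ⟨m', hm', hmI', F', hF'⟩ := hy
    refine ⟨m + m', add_nonneg hm hm', fun k hk => by simp [hmI k hk, hmI' k hk],
      ⟨F.1 * F'.1, ?_⟩, ?_⟩
    · rw [deg_add]
      exact MvPolynomial.IsWeightedHomogeneous.mul F.2 F'.2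
    · rw [map_mul, ← hF, ← hF', mon_add]
      ring

lemma Chart.local_ne_zero (n : ℕ) (I : Chart) {e : ℤ × ℤ} {f : GlobalSections n e}
    (hf : f.1 ≠ 0) : I.local n f ≠ 0 := by
  intro h
  have h' : algebraMap Cox CoxField f / mon (I.gen n e) = 0 := congrArg Subtype.val h
  rw [div_eq_zero_iff, or_iff_left (mon_ne_zero _)] at h'
  exact hf ((IsFractionRing.injective Cox CoxField).eq_iff' (map_zero _) |>.mp h')

/-- Coprime sections have coprime local equations: the coprimality descends from the Cox ring
because the chart ring is the degree zero part of a localization of it. -/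
lemma Chart.exists_eq_local_mul (n : ℕ) (I : Chart) {e e' : ℤ × ℤ} {f : GlobalSections n e}
    {g : GlobalSections n e'} (hfg : IsRelPrime f.1 g.1) (x y : I.ring n)
    (h : I.local n f * x = I.local n g * y) : ∃ z, y = I.local n f * z := by
  obtain ⟨x, hx⟩ := x
  obtain ⟨y, hy⟩ := y
  replace h : algebraMap Cox CoxField f / mon (I.gen n e) * x =
    algebraMap Cox CoxField g / mon (I.gen n e') * y := congrArg Subtype.val h
  obtain ⟨p, hp, hpI, X, hX⟩ := I.exists_eq_div_mon n hx
  obtain ⟨q, hq, hqI, Y, hY⟩ := I.exists_eq_div_mon n hy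
  -- multiplication by this monomial clears the negative exponents of the two generators
  let r : Fin 4 → ℤ := fun k => |I.gen n e k| + |I.gen n e' k|
  have hr : 0 ≤ r := fun k => add_nonneg (abs_nonneg _) (abs_nonneg _)
  have hrI (k) (hk : k ∉ I.vars) : r k = 0 := by
    simp [r, Chart.gen_apply_eq_zero n I _ hk]
  have h1 : 0 ≤ I.gen n e + r := fun k => by
    have := neg_abs_le (I.gen n e k)
    have := abs_nonneg (I.gen n e' k)
    simp only [r, Pi.add_apply, Pi.zero_apply]
    omega
  have h2 : 0 ≤ I.gen n e' + r := fun k => by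
    have := neg_abs_le (I.gen n e' k)
    have := abs_nonneg (I.gen n e k)
    simp only [r, Pi.add_apply, Pi.zero_apply]
    omega
  have n1 := mon_ne_zero (I.gen n e)
  have n2 := mon_ne_zero (I.gen n e')
  have hT : 0 ≤ I.gen n e + r + p := add_nonneg h1 hp
  have key : f.1 * (X.1 * coxMon (I.gen n e' + r + q)) = g.1 * (Y.1 * coxMon (I.gen n e + r + p)) := by
    refine IsFractionRing.injective Cox CoxField ?_
    simp only [map_mul]
    rw [← hX, ← hY, algebraMap_coxMon (add_nonneg h2 hq), algebraMap_coxMon hT,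
      mon_add, mon_add, mon_add, mon_add]
    field_simp at h
    linear_combination mon r * mon q * mon p * h
  obtain ⟨Z, hZ⟩ := hfg.dvd_of_dvd_mul_left ⟨_, key.symm⟩
  obtain ⟨Z, hZ'⟩ := exists_homogeneous_factor (D := deg n (r + p + q)) f Z (by
    rw [← hZ]
    have := MvPolynomial.IsWeightedHomogeneous.mul Y.2 (coxMon_mem n hT)
    rwa [← deg_add, show q + (I.gen n e + r + p) = I.gen n e + (r + p + q) by abel, deg_add,
      Chart.deg_gen] at this)
  refine ⟨⟨_, I.div_mon_mem n (m := r + p + q)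
    (fun k hk => by simp [hrI k hk, hpI k hk, hqI k hk]) Z⟩, Subtype.ext ?_⟩
  change y = algebraMap Cox CoxField f / mon (I.gen n e) * (algebraMap Cox CoxField Z / _)
  have h3 := congrArg (algebraMap Cox CoxField) (hZ.trans hZ'.symm)
  rw [map_mul, map_mul, algebraMap_coxMon hT, ← hY, mon_add, mon_add] at h3
  rw [mon_add, mon_add]
  have n3 := mon_ne_zero r
  have n4 := mon_ne_zero p
  have n5 := mon_ne_zero q
  field_simp
  linear_combination h3

/-! ### Division of functions on open subsets of affine schemes -/

/-- The property that `a` divides `y` whenever it divides `b * y` passes to localizations. -/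
lemma exists_eq_mul_of_isLocalization {R S : Type*} [CommRing R] [CommRing S] [Algebra R S]
    (M : Submonoid R) [IsLocalization M S] {a b : R}
    (hab : ∀ x y : R, a * x = b * y → ∃ z, y = a * z) (x y : S)
    (h : algebraMap R S a * x = algebraMap R S b * y) : ∃ z, y = algebraMap R S a * z := by
  obtain ⟨⟨X, s⟩, hX⟩ := IsLocalization.surj M x
  obtain ⟨⟨Y, t⟩, hY⟩ := IsLocalization.surj M y
  dsimp only at hX hY
  obtain ⟨u, hu⟩ := (IsLocalization.eq_iff_exists M S (x := a * (X * t)) (y := b * (Y * s))).mp (by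
    simp only [map_mul]
    rw [← hX, ← hY]
    linear_combination algebraMap R S s * algebraMap R S t * h)
  obtain ⟨z, hz⟩ := hab (u * (X * t)) (u * (Y * s)) (by linear_combination hu)
  have hv := IsLocalization.map_units S (u * s * t)
  refine ⟨algebraMap R S z * ↑hv.unit⁻¹, ?_⟩
  rw [← mul_assoc, Units.eq_mul_inv_iff_mul_eq, ← map_mul, ← hz, IsUnit.unit_spec]
  simp only [Submonoid.coe_mul, map_mul]
  rw [← hY]
  ring

/-- The restriction of functions to a smaller open set, as a ring homomorphism. -/
def resHom (X : Scheme.{0}) {U V : X.Opens} (h : V ≤ U) : Γ(X, U) →+* Γ(X, V) :=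
  (X.presheaf.map (homOfLE h).op).hom

lemma resHom_resHom (X : Scheme.{0}) {U V W : X.Opens} (h : V ≤ U) (h' : W ≤ V) (x : Γ(X, U)) :
    resHom X h' (resHom X h x) = resHom X (h'.trans h) x := by
  change (X.presheaf.map (homOfLE h).op ≫ X.presheaf.map (homOfLE h').op).hom x = _
  rw [← Functor.map_comp]
  rfl

lemma eq_of_resHom_eq (X : Scheme.{0}) {U : X.Opens} {κ : Type} {W : κ → X.Opens}
    (hW : ∀ i, W i ≤ U) (hcov : U ≤ iSup W) {x y : Γ(X, U)}
    (h : ∀ i, resHom X (hW i) x = resHom X (hW i) y) : x = y :=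
  X.sheaf.eq_of_locally_eq' W U (fun i => homOfLE (hW i)) hcov x y h

/-- Quotients by an element that is cancellable on every open subset are unique, so they glue. -/
lemma exists_eq_mul_of_cover (X : Scheme.{0}) {U : X.Opens} {κ : Type} {W : κ → X.Opens}
    (hW : ∀ i, W i ≤ U) (hcov : U ≤ iSup W) {a y : Γ(X, U)}
    (ha : ∀ (V : X.Opens) (hV : V ≤ U) (x x' : Γ(X, V)),
      resHom X hV a * x = resHom X hV a * x' → x = x')
    (h : ∀ i, ∃ z, resHom X (hW i) y = resHom X (hW i) a * z) : ∃ z, y = a * z := by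
  choose z hz using h
  obtain ⟨w, hw, -⟩ := X.sheaf.existsUnique_gluing' W U (fun i => homOfLE (hW i)) hcov z (by
    intro i j
    refine ha (W i ⊓ W j) (inf_le_left.trans (hW i)) _ _ ?_
    have h1 := congrArg (resHom X (inf_le_left : W i ⊓ W j ≤ W i)) (hz i)
    have h2 := congrArg (resHom X (inf_le_right : W i ⊓ W j ≤ W j)) (hz j)
    rw [map_mul, resHom_resHom, resHom_resHom] at h1 h2
    exact h1.symm.trans h2)
  let w' : Γ(X, U) := w
  have hw' (i) : resHom X (hW i) w' = z i := hw i
  refine ⟨w', eq_of_resHom_eq X hW hcov fun i => ?_⟩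
  rw [map_mul, hz, hw']

lemma resHom_toSpec {R : CommRingCat.{0}} {U V : (Spec R).Opens} (h : V ≤ U) (a : R) :
    resHom (Spec R) h ((toSpec R U).hom a) = (toSpec R V).hom a :=
  congr($(toSpec_map R (homOfLE h).op).hom a)

/-- The principal open subset where `f` does not vanish. -/
def principalOpen {R : CommRingCat.{0}} (f : R) : (Spec R).Opens := PrimeSpectrum.basicOpen f

lemma le_iSup_principalOpen {R : CommRingCat.{0}} (U : (Spec R).Opens) :
    U ≤ ⨆ f : {f : R // principalOpen f ≤ U}, principalOpen f.1 := fun p hp => by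
  obtain ⟨_, ⟨_, ⟨f, rfl⟩, rfl⟩, hpf, hf⟩ :=
    PrimeSpectrum.isBasis_basic_opens.exists_subset_of_mem_open hp U.2
  exact Opens.mem_iSup.mpr ⟨⟨f, hf⟩, hpf⟩

lemma isLocalization_principalOpen {R : CommRingCat.{0}} (f : R) :
    letI := (toSpec R (principalOpen f)).hom.toAlgebra
    IsLocalization.Away f Γ(Spec R, principalOpen f) := by
  have h (A : Algebra R Γ(Spec R, principalOpen f))
      (hA : A = StructureSheaf.openAlgebra R (op (PrimeSpectrum.basicOpen f))) :
      @IsLocalization.Away R _ f Γ(Spec R, principalOpen f) _ A := by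
    subst hA
    exact StructureSheaf.IsLocalization.to_basicOpen R f
  exact h _ (Algebra.algebra_ext _ _ fun r => rfl)

/-- A nonzerodivisor of a ring `R` stays a nonzerodivisor on every open subset of `Spec R`. -/
lemma toSpec_mul_cancel {R : CommRingCat.{0}} {a : R} (ha : a ∈ nonZeroDivisors R)
    (U : (Spec R).Opens) (x y : Γ(Spec R, U))
    (h : (toSpec R U).hom a * x = (toSpec R U).hom a * y) : x = y := by
  refine eq_of_resHom_eq (Spec R) (fun f : {f : R // principalOpen f ≤ U} => f.2)
    (le_iSup_principalOpen U) fun f => ?_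
  have ha' : (toSpec R (principalOpen f.1)).hom a ∈ nonZeroDivisors Γ(Spec R, principalOpen f.1) := by
    let _ := (toSpec R (principalOpen f.1)).hom.toAlgebra
    have := isLocalization_principalOpen f.1
    exact IsLocalization.map_nonZeroDivisors_le (Submonoid.powers f.1)
      Γ(Spec R, principalOpen f.1) ⟨a, ha, rfl⟩
  refine (mul_cancel_left_mem_nonZeroDivisors ha').mp ?_
  have h' := congrArg (resHom (Spec R) f.2) h
  rwa [map_mul, map_mul, resHom_toSpec] at h'

/-- If `a` divides `y` whenever it divides `b * y`, then this remains true on every open subset of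
`Spec R`. -/
lemma exists_eq_toSpec_mul {R : CommRingCat.{0}} {a b : R} (ha : a ∈ nonZeroDivisors R)
    (hab : ∀ x y : R, a * x = b * y → ∃ z, y = a * z) (U : (Spec R).Opens) (x y : Γ(Spec R, U))
    (h : (toSpec R U).hom a * x = (toSpec R U).hom b * y) : ∃ z, y = (toSpec R U).hom a * z := by
  refine exists_eq_mul_of_cover (Spec R) (fun f : {f : R // principalOpen f ≤ U} => f.2)
    (le_iSup_principalOpen U) (fun V hV x x' hx => ?_) fun f => ?_
  · rw [resHom_toSpec] at hx
    exact toSpec_mul_cancel ha V x x' hx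
  · have h' := congrArg (resHom (Spec R) f.2) h
    rw [map_mul, map_mul, resHom_toSpec, resHom_toSpec] at h'
    rw [resHom_toSpec]
    let _ := (toSpec R (principalOpen f.1)).hom.toAlgebra
    have := isLocalization_principalOpen f.1
    exact exists_eq_mul_of_isLocalization (Submonoid.powers f.1) hab _ _ h'

/-! ### Division of morphisms into the sheaves `𝒪(a, b)` -/

lemma Chart.local_mul_cancel (n : ℕ) (I : Chart) {e : ℤ × ℤ} {f : GlobalSections n e}
    (hf : f.1 ≠ 0) (W : (surface n).Opens) (x y : I.functions n W)
    (h : I.toFunctions n W (I.local n f) * x = I.toFunctions n W (I.local n f) * y) : x = y :=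
  toSpec_mul_cancel (R := CommRingCat.of (I.ring n))
    (mem_nonZeroDivisors_of_ne_zero (I.local_ne_zero n hf)) _ x y h

lemma mulSections_injective (n : ℕ) {e d d' : ℤ × ℤ} {f : GlobalSections n e} (hf : f.1 ≠ 0)
    (h : d + e = d') (W : (surface n).Opens) : Function.Injective (mulSections n f h W) :=
  fun _ _ hs => Subtype.ext <| funext fun I =>
    I.local_mul_cancel n hf W _ _ (congrFun (congrArg Subtype.val hs) I)

lemma exists_eq_mulSections (n : ℕ) {e e' d d₁ d₂ d₃ : ℤ × ℤ} {f : GlobalSections n e}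
    {g : GlobalSections n e'} (hf : f.1 ≠ 0) (hfg : IsRelPrime f.1 g.1) (h₁ : d₁ + e = d₃)
    (h₂ : d₂ + e' = d₃) (h : d + e = d₂) (W : (surface n).Opens) (s : sections n d₁ W)
    (s' : sections n d₂ W) (hs : mulSections n f h₁ W s = mulSections n g h₂ W s') :
    ∃ z, mulSections n f h W z = s' := by
  have hex (I : Chart) : ∃ z : I.functions n W, s'.1 I = I.toFunctions n W (I.local n f) * z :=
    exists_eq_toSpec_mul (R := CommRingCat.of (I.ring n))
      (mem_nonZeroDivisors_of_ne_zero (I.local_ne_zero n hf)) (I.exists_eq_local_mul n hfg) _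
      (s.1 I) (s'.1 I) (congrFun (congrArg Subtype.val hs) I)
  choose z hz using hex
  refine ⟨⟨z, fun I J hIJ => ?_⟩, Subtype.ext <| funext fun I => (hz I).symm⟩
  refine J.local_mul_cancel n hf W _ _ ?_
  rw [← hz, s'.2 I J hIJ, hz, map_mul, Chart.restrict_toFunctions, ← mul_assoc, ← mul_assoc,
    ← map_mul, ← map_mul]
  congr 2
  refine Subtype.ext ?_
  change mon (I.gen n d₂ - J.gen n d₂) * (algebraMap Cox CoxField f / mon (I.gen n e)) =
    algebraMap Cox CoxField f / mon (J.gen n e) * mon (I.gen n d - J.gen n d)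
  subst h
  rw [Chart.gen_add, Chart.gen_add, mon_sub, mon_sub, mon_add, mon_add]
  have h1 := mon_ne_zero (I.gen n e)
  have h2 := mon_ne_zero (J.gen n e)
  have h3 := mon_ne_zero (J.gen n d)
  field_simp

lemma modules_hom_ext {X : Scheme.{0}} {T T' : X.Modules} {φ ψ : T ⟶ T'}
    (h : ∀ (W : X.Opensᵒᵖ) (t : T.val.obj W), φ.val.app W t = ψ.val.app W t) : φ = ψ :=
  SheafOfModules.hom_ext <| PresheafOfModules.hom_ext fun W =>
    ModuleCat.hom_ext <| LinearMap.ext fun t => h W t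

lemma mono_mul (n : ℕ) {e d d' : ℤ × ℤ} {f : GlobalSections n e} (hf : f.1 ≠ 0)
    (h : d + e = d') : Mono (mul n f h) := by
  refine ⟨fun {T} u v huv => modules_hom_ext fun W t => ?_⟩
  refine mulSections_injective n hf h W.unop ?_
  exact congr(($huv).val.app W t)

/-- A morphism into `𝒪(a, b)` factors through multiplication by `f` as soon as its sections are
divisible by `f`: the quotients are unique, so that they are additive, linear and compatible with
restriction. -/
lemma exists_comp_mul_eq (n : ℕ) {e d d' : ℤ × ℤ} {f : GlobalSections n e} (hf : f.1 ≠ 0)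
    (h : d + e = d') {T : (surface n).Modules} (y : T ⟶ O n d')
    (hy : ∀ (W : (surface n).Opensᵒᵖ) (t : T.val.obj W),
      ∃ z : sections n d W.unop, mulSections n f h W.unop z = y.val.app W t) :
    ∃ z : T ⟶ O n d, z ≫ mul n f h = y := by
  choose q hq using hy
  let z : T ⟶ O n d :=
    { val := PresheafOfModules.homMk
        { app W := AddCommGrpCat.ofHom (AddMonoidHom.mk' (q W) fun t t' => by
            refine mulSections_injective n hf h W.unop ?_
            exact (hq W _).trans <| (map_add (y.val.app W).hom t t').trans <|
              (congrArg₂ (· + ·) (hq W t) (hq W t')).symm.trans (map_add (mulSections n f h W.unop) _ _).symm)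
          naturality W W' i := by
            refine AddCommGrpCat.hom_ext <| AddMonoidHom.ext fun t => ?_
            refine mulSections_injective n hf h W'.unop ?_
            exact (hq W' _).trans <| (PresheafOfModules.naturality_apply y.val i t).trans <|
              (congrArg ((O n d').val.map i) (hq W t)).symm.trans
                (PresheafOfModules.naturality_apply (mul n f h).val i (q W t)).symm }
        fun W r t => by
          refine mulSections_injective n hf h W.unop ?_
          exact (hq W _).trans <| (map_smul (y.val.app W).hom r t).trans <|
            (congrArg (fun s : (O n d').val.obj W => r • s) (hq W t)).symm.trans
              (map_smul ((mul n f h).val.app W).hom r (show (O n d).val.obj W from q W t)).symm }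
  exact ⟨z, modules_hom_ext fun W t => hq W t⟩

/-- If `f` and `g` are coprime, then a morphism whose multiple by `g` is a multiple of `f` is itself
a multiple of `f`. -/
lemma exists_comp_mul_eq_of_isRelPrime (n : ℕ) {e e' d d₁ d₂ d₃ : ℤ × ℤ} {f : GlobalSections n e}
    {g : GlobalSections n e'} (hf : f.1 ≠ 0) (hfg : IsRelPrime f.1 g.1) (h₁ : d₁ + e = d₃)
    (h₂ : d₂ + e' = d₃) (h : d + e = d₂) {T : (surface n).Modules} (x : T ⟶ O n d₁)
    (y : T ⟶ O n d₂) (hxy : x ≫ mul n f h₁ = y ≫ mul n g h₂) :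
    ∃ z : T ⟶ O n d, z ≫ mul n f h = y :=
  exists_comp_mul_eq n hf h y fun W t => exists_eq_mulSections n hf hfg h₁ h₂ h W.unop
    (x.val.app W t) (y.val.app W t) congr(($hxy).val.app W t)

/-! ### Matrices of sections -/

/-- The determinant is homogeneous if each row is, possibly of different degrees. -/
lemma det_mem {n c : ℕ} {A : Matrix (Fin c) (Fin c) Cox} {ε : Fin c → ℤ × ℤ}
    (hA : ∀ i j, A i j ∈ GlobalSections n (ε i)) : A.det ∈ GlobalSections n (∑ i, ε i) := by
  rw [← Matrix.det_transpose, Matrix.det_apply]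
  refine Submodule.sum_mem _ fun σ _ => ?_
  rw [Units.smul_def]
  exact zsmul_mem (MvPolynomial.IsWeightedHomogeneous.prod _ _ _ fun i _ => hA i (σ i)) _

lemma det_mem_nsmul {n c : ℕ} {A : Matrix (Fin c) (Fin c) Cox} {e : ℤ × ℤ}
    (hA : ∀ i j, A i j ∈ GlobalSections n e) : A.det ∈ GlobalSections n (c • e) := by
  simpa using det_mem hA

lemma adjugate_mem {n c : ℕ} {A : Matrix (Fin c) (Fin c) Cox} {e : ℤ × ℤ}
    (hA : ∀ i j, A i j ∈ GlobalSections n e) (i j : Fin c) :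
    A.adjugate i j ∈ GlobalSections n (c • e - e) := by
  -- the entries of the adjugate are determinants with one row of degree `0` instead of `e`
  have h := det_mem (n := n) (A := A.updateRow j (Pi.single i 1))
    (ε := fun k => e - if k = j then e else 0) fun k l => by
      rw [Matrix.updateRow_apply]
      split_ifs with hk
      · rw [sub_self, Pi.single_apply]
        split_ifs
        · exact MvPolynomial.isWeightedHomogeneous_one ℂ (wt n)
        · exact zero_mem _
      · rw [sub_zero]
        exact hA k l
  rw [Matrix.adjugate_apply]
  simpa using h

lemma scalar_mem {n c : ℕ} {e : ℤ × ℤ} (f : GlobalSections n e) (i j : Fin c) :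
    Matrix.scalar (Fin c) f.1 i j ∈ GlobalSections n e := by
  rw [Matrix.scalar_apply, Matrix.diagonal_apply]
  split_ifs
  · exact f.2
  · exact zero_mem _

lemma pencilMatrix_mem {n c : ℕ} (M : Matrix (Fin c) (Fin c) ℂ) {e : ℤ × ℤ}
    (f g : GlobalSections n e) (i j : Fin c) :
    pencilMatrix M f.1 g.1 i j ∈ GlobalSections n e := by
  refine add_mem (scalar_mem f i j) ?_
  rw [Matrix.smul_apply, Matrix.map_apply, smul_eq_mul, mul_comm, ← MvPolynomial.smul_eq_C_mul]
  exact Submodule.smul_mem _ _ g.2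

lemma matrix_mul_mem {n c : ℕ} {e e' : ℤ × ℤ} {A A' : Matrix (Fin c) (Fin c) Cox}
    (hA : ∀ i j, A i j ∈ GlobalSections n e) (hA' : ∀ i j, A' i j ∈ GlobalSections n e')
    (i j : Fin c) : (A' * A) i j ∈ GlobalSections n (e + e') := by
  rw [Matrix.mul_apply]
  refine Submodule.sum_mem _ fun k _ => ?_
  rw [mul_comm]
  exact MvPolynomial.IsWeightedHomogeneous.mul (hA k j) (hA' i k)

/-- The morphism `𝒪(a, b)ᶜ ⟶ 𝒪(a + a', b + b')ᶜ` given by a matrix of sections of `𝒪(a', b')`. The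
composition of such morphisms is matrix multiplication in reverse order. -/
def matMap (n : ℕ) {c : ℕ} {e d d' : ℤ × ℤ} (A : Matrix (Fin c) (Fin c) Cox)
    (hA : ∀ i j, A i j ∈ GlobalSections n e) (h : d + e = d') : tensorO n c d ⟶ tensorO n c d' :=
  biproduct.matrix fun j i => mul n ⟨A i j, hA i j⟩ h

lemma matMap_congr (n : ℕ) {c : ℕ} {e e' d d' : ℤ × ℤ} {A A' : Matrix (Fin c) (Fin c) Cox}
    (hAA' : A = A') (hA : ∀ i j, A i j ∈ GlobalSections n e)
    (hA' : ∀ i j, A' i j ∈ GlobalSections n e') (h : d + e = d') (h' : d + e' = d') :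
    matMap n A hA h = matMap n A' hA' h' := by
  obtain rfl : e = e' := add_left_cancel (h.trans h'.symm)
  subst hAA'
  rfl

lemma matMap_comp (n : ℕ) {c : ℕ} {e e' d d' d'' : ℤ × ℤ} {A A' : Matrix (Fin c) (Fin c) Cox}
    (hA : ∀ i j, A i j ∈ GlobalSections n e) (hA' : ∀ i j, A' i j ∈ GlobalSections n e')
    (h : d + e = d') (h' : d' + e' = d'') :
    matMap n A hA h ≫ matMap n A' hA' h' =
      matMap n (A' * A) (matrix_mul_mem hA hA') (by rw [← h', ← h, add_assoc]) := by
  unfold matMap tensorO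
  refine biproduct.hom_ext' _ _ fun j => biproduct.hom_ext _ _ fun i => ?_
  simp only [Category.assoc, biproduct.matrix_π, biproduct.ι_matrix_assoc,
    biproduct.ι_matrix, biproduct.lift_desc, biproduct.lift_π, mul_comp]
  rw [← mul_sum']
  refine mul_congr n rfl ?_ _ _
  refine (AddSubmonoidClass.coe_finsetSum _ _).trans (Eq.trans ?_ (Matrix.mul_apply ..).symm)
  exact Finset.sum_congr rfl fun k _ => mul_comm _ _

/-- The coordinates of `V' ⊗ 𝒪(a, b)` with respect to the basis of `V'`. -/
def coord (n : ℕ) {c : ℕ} (d : ℤ × ℤ) (i : Fin c) : tensorO n c d ⟶ O n d :=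
  biproduct.π (fun _ : Fin c => O n d) i

lemma coord_hom_ext (n : ℕ) {c : ℕ} {d : ℤ × ℤ} {T : (surface n).Modules}
    {u v : T ⟶ tensorO n c d} (h : ∀ i, u ≫ coord n d i = v ≫ coord n d i) : u = v :=
  biproduct.hom_ext u v h

lemma exists_comp_coord_eq (n : ℕ) {c : ℕ} {d : ℤ × ℤ} {T : (surface n).Modules}
    (z : Fin c → (T ⟶ O n d)) : ∃ u : T ⟶ tensorO n c d, ∀ i, u ≫ coord n d i = z i :=
  ⟨biproduct.lift z, fun i => biproduct.lift_π z i⟩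

lemma matMap_scalar_coord (n : ℕ) {c : ℕ} {e d d' : ℤ × ℤ} (f : GlobalSections n e)
    (h : d + e = d') (i : Fin c) :
    matMap n (Matrix.scalar (Fin c) f.1) (scalar_mem f) h ≫ coord n d' i =
      coord n d i ≫ mul n f h := by
  unfold matMap coord tensorO
  refine biproduct.hom_ext' _ _ fun j => ?_
  rw [biproduct.matrix_π, biproduct.ι_desc]
  by_cases hij : j = i
  · subst hij
    rw [biproduct.ι_π_self_assoc]
    exact mul_congr n rfl (by simp) _ _
  · rw [biproduct.ι_π_ne_assoc _ hij, zero_comp]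
    refine (mul_congr n (g := 0) rfl ?_ _ _).trans
      (map_zero (AddMonoidHom.mk' (fun f => mul n f h) fun f g => mul_add' n f g h))
    simp [Ne.symm hij]

lemma pencil_eq_matMap {n c : ℕ} {V' : Type*} [AddCommGroup V'] [Module ℂ V']
    (B : Module.Basis (Fin c) ℂ V') (b : Module.End ℂ V') {e d d' : ℤ × ℤ}
    (f g : GlobalSections n e) (h : d + e = d') :
    pencil B 1 b f g h = matMap n (pencilMatrix (LinearMap.toMatrix B B b) f.1 g.1)
      (pencilMatrix_mem _ f g) h := by
  unfold pencil tensorMap matMap tensorO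
  refine biproduct.hom_ext' _ _ fun j => biproduct.hom_ext _ _ fun i => ?_
  simp only [Preadditive.comp_add, Preadditive.add_comp, biproduct.ι_matrix, biproduct.lift_π]
  rw [← mul_add']
  refine mul_congr n rfl ?_ _ _
  simp only [pencilMatrix, LinearMap.toMatrix_one, Matrix.add_apply, Matrix.scalar_apply,
    Matrix.diagonal_apply, Matrix.one_apply, Matrix.smul_apply, Matrix.map_apply, smul_eq_mul,
    Submodule.coe_add, Submodule.coe_smul, MvPolynomial.smul_eq_C_mul]
  split_ifs <;> simp [mul_comm]

lemma mono_matMap_scalar (n : ℕ) {c : ℕ} {e d d' : ℤ × ℤ} {f : GlobalSections n e}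
    (hf : f.1 ≠ 0) (h : d + e = d') :
    Mono (matMap n (Matrix.scalar (Fin c) f.1) (scalar_mem f) h) := by
  have := mono_mul n hf h
  refine ⟨fun u v huv => coord_hom_ext n fun i => ?_⟩
  rw [← cancel_mono (mul n f h), Category.assoc, Category.assoc, ← matMap_scalar_coord,
    ← Category.assoc, ← Category.assoc, huv]

/-- A matrix of sections with nonzero determinant is injective, since its composition with the
adjugate matrix is. -/
lemma mono_matMap (n : ℕ) {c : ℕ} {e d d' : ℤ × ℤ} {A : Matrix (Fin c) (Fin c) Cox}
    (hA : ∀ i j, A i j ∈ GlobalSections n e) (hdet : A.det ≠ 0) (h : d + e = d') :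
    Mono (matMap n A hA h) := by
  have h' : d' + (c • e - e) = d + c • e := by rw [← h]; abel
  have := mono_matMap_scalar n (c := c) (f := ⟨A.det, det_mem_nsmul hA⟩) hdet (d := d) rfl
  have hcomp : matMap n A hA h ≫ matMap n A.adjugate (adjugate_mem hA) h' =
      matMap n (Matrix.scalar (Fin c) A.det) (scalar_mem ⟨A.det, det_mem_nsmul hA⟩) rfl := by
    rw [matMap_comp]
    refine matMap_congr n ?_ _ _ _ _
    rw [Matrix.adjugate_mul, Matrix.scalar_apply, Matrix.smul_one_eq_diagonal]
  rw [← hcomp] at this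
  exact mono_of_mono _ (matMap n A.adjugate (adjugate_mem hA) h')

lemma exists_comp_matMap_scalar_eq (n : ℕ) {c : ℕ} {e e' d d₁ d₂ d₃ : ℤ × ℤ}
    {f : GlobalSections n e} {g : GlobalSections n e'} (hf : f.1 ≠ 0) (hfg : IsRelPrime f.1 g.1)
    (h₁ : d₁ + e = d₃) (h₂ : d₂ + e' = d₃) (h : d + e = d₂) {T : (surface n).Modules}
    (x : T ⟶ tensorO n c d₁) (y : T ⟶ tensorO n c d₂)
    (hxy : x ≫ matMap n (Matrix.scalar (Fin c) f.1) (scalar_mem f) h₁ =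
      y ≫ matMap n (Matrix.scalar (Fin c) g.1) (scalar_mem g) h₂) :
    ∃ z : T ⟶ tensorO n c d, z ≫ matMap n (Matrix.scalar (Fin c) f.1) (scalar_mem f) h = y := by
  have hex (i : Fin c) := exists_comp_mul_eq_of_isRelPrime n hf hfg h₁ h₂ h
    (x ≫ coord n d₁ i) (y ≫ coord n d₂ i) (by
      rw [Category.assoc, Category.assoc, ← matMap_scalar_coord, ← matMap_scalar_coord,
        ← Category.assoc, ← Category.assoc, hxy])
  choose z hz using hex
  obtain ⟨w, hw⟩ := exists_comp_coord_eq n z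
  refine ⟨w, coord_hom_ext n fun i => ?_⟩
  rw [Category.assoc, matMap_scalar_coord, ← Category.assoc, hw, hz]

lemma adjugate_mul_comm {R : Type*} [CommRing R] [IsDomain R] {c : ℕ}
    {P Q : Matrix (Fin c) (Fin c) R} (hPQ : P * Q = Q * P) (hQ : Q.det ≠ 0) :
    Q.adjugate * P = P * Q.adjugate := by
  refine smul_right_injective _ hQ ?_
  calc Q.det • (Q.adjugate * P) = Q.adjugate * P * (Q * Q.adjugate) := by
        rw [Matrix.mul_adjugate, Matrix.mul_smul, Matrix.mul_one]
    _ = Q.adjugate * (P * Q) * Q.adjugate := by simp only [Matrix.mul_assoc]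
    _ = (Q.adjugate * Q) * P * Q.adjugate := by rw [hPQ]; simp only [Matrix.mul_assoc]
    _ = Q.det • (P * Q.adjugate) := by
        rw [Matrix.adjugate_mul, Matrix.smul_mul, Matrix.smul_mul, Matrix.one_mul]

/-- The Koszul complex of two commuting matrices of sections with coprime determinants is exact in
the middle: if `Q u = P v`, then `(u, v) = (P z, Q z)`. Multiplication by both adjugates gives
`det Q (adj P u) = det P (adj Q v)`, so that `adj Q v` is divisible by `det Q`; the quotient is
`z`. -/
lemma exists_comp_matMap_eq (n : ℕ) {c : ℕ} {e e' d d₁ d₂ d₃ : ℤ × ℤ}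
    {P Q : Matrix (Fin c) (Fin c) Cox} (hQ : ∀ i j, Q i j ∈ GlobalSections n e)
    (hP : ∀ i j, P i j ∈ GlobalSections n e') (hPQ : P * Q = Q * P) (hdet : Q.det ≠ 0)
    (hrel : IsRelPrime Q.det P.det) (h₁ : d₁ + e = d₃) (h₂ : d₂ + e' = d₃) (h₁' : d + e' = d₁)
    (h₂' : d + e = d₂) {T : (surface n).Modules} (u : T ⟶ tensorO n c d₁) (v : T ⟶ tensorO n c d₂)
    (huv : u ≫ matMap n Q hQ h₁ = v ≫ matMap n P hP h₂) :
    ∃ z : T ⟶ tensorO n c d, z ≫ matMap n P hP h₁' = u ∧ z ≫ matMap n Q hQ h₂' = v := by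
  have hcomm := adjugate_mul_comm hPQ hdet
  let δQ : GlobalSections n (c • e) := ⟨Q.det, det_mem_nsmul hQ⟩
  let δP : GlobalSections n (c • e') := ⟨P.det, det_mem_nsmul hP⟩
  let aQ := adjugate_mem hQ
  let aP := adjugate_mem hP
  have hs (A : Matrix (Fin c) (Fin c) Cox) : Matrix.scalar (Fin c) A.det = A.adjugate * A := by
    rw [Matrix.adjugate_mul, Matrix.scalar_apply, Matrix.smul_one_eq_diagonal]
  have hs' (A : Matrix (Fin c) (Fin c) Cox) : Matrix.scalar (Fin c) A.det = A * A.adjugate := by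
    rw [Matrix.mul_adjugate, Matrix.scalar_apply, Matrix.smul_one_eq_diagonal]
  have k₁ : d₁ + (c • e' - e') = d + c • e' := by rw [← h₁']; abel
  have k₂ : d₂ + (c • e - e) = d + c • e := by rw [← h₂']; abel
  have k₃ : d₃ + ((c • e - e) + (c • e' - e')) = d + c • e + c • e' := by
    rw [← h₁, ← h₁']; abel
  have k₄ : d + c • e' + c • e = d + c • e + c • e' := by abel
  obtain ⟨z, hz⟩ := exists_comp_matMap_scalar_eq n (f := δQ) (g := δP) hdet hrel k₄ rfl rfl
    (u ≫ matMap n P.adjugate aP k₁) (v ≫ matMap n Q.adjugate aQ k₂) (by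
      have h := congrArg (· ≫ matMap n (P.adjugate * Q.adjugate) (matrix_mul_mem aQ aP) k₃) huv
      simp only [Category.assoc, matMap_comp] at h ⊢
      refine (congrArg (u ≫ ·) (matMap_congr n ?_ _ _ _ _)).trans
        (h.trans (congrArg (v ≫ ·) (matMap_congr n ?_ _ _ _ _)))
      · rw [Matrix.mul_assoc, ← hs, Matrix.scalar_commute _ (fun _ => Commute.all _ _)]
      · rw [Matrix.mul_assoc, hcomm, ← Matrix.mul_assoc, ← hs])
  have hmono := mono_matMap_scalar n (c := c) (f := δQ) hdet (d := d₂) rfl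
  have hv : z ≫ matMap n Q hQ h₂' = v := by
    have k₅ : d + c • e + e = d₂ + c • e := by rw [← h₂']; abel
    have h := congrArg (· ≫ matMap n Q hQ k₅) hz
    rw [← cancel_mono (matMap n (Matrix.scalar (Fin c) δQ.1) (scalar_mem δQ) rfl)]
    simp only [Category.assoc, matMap_comp] at h ⊢
    refine (congrArg (z ≫ ·) (matMap_congr n ?_ _ _ _ _)).trans
      (h.trans (congrArg (v ≫ ·) (matMap_congr n ?_ _ _ _ _)))
    · rw [Matrix.scalar_commute _ (fun _ => Commute.all _ _)]
    · rw [← hs']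
  refine ⟨z, ?_, hv⟩
  have := mono_matMap n hQ hdet h₁
  rw [← cancel_mono (matMap n Q hQ h₁), huv, ← hv]
  simp only [Category.assoc, matMap_comp]
  exact congrArg (z ≫ ·) (matMap_congr n hPQ.symm _ _ _ _)

/-! ### Exactness of the complex -/

section

variable {𝒞 : Type*} [Category 𝒞] [Abelian 𝒞] {A B C : 𝒞}

lemma isZero_homology_threeTerm_neg_one (α : A ⟶ B) (β : B ⟶ C) (w : α ≫ β = 0) [Mono α] :
    IsZero ((threeTerm α β w).homology (-1)) := by
  rw [← HomologicalComplex.exactAt_iff_isZero_homology,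
    HomologicalComplex.exactAt_iff' _ (-2) (-1) 0 (by simp) (by simp)]
  refine (ShortComplex.exact_iff_mono _ rfl).mpr ?_
  change Mono α
  infer_instance

lemma isZero_homology_threeTerm_zero (α : A ⟶ B) (β : B ⟶ C) (w : α ≫ β = 0)
    (h : ∀ {T : 𝒞} (x : T ⟶ B), x ≫ β = 0 → ∃ z : T ⟶ A, z ≫ α = x) :
    IsZero ((threeTerm α β w).homology 0) := by
  rw [← HomologicalComplex.exactAt_iff_isZero_homology,
    HomologicalComplex.exactAt_iff' _ (-1) 0 1 (by simp) (by simp),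
    ShortComplex.exact_iff_exact_up_to_refinements]
  intro T x hx
  obtain ⟨z, hz⟩ := h x hx
  exact ⟨T, 𝟙 T, inferInstance, z, (Category.id_comp x).trans hz.symm⟩

end

lemma pencilMatrix_mul_comm {c : ℕ} {M N : Matrix (Fin c) (Fin c) ℂ} (h : M * N = N * M)
    (a b a' b' : Cox) :
    pencilMatrix M a b * pencilMatrix N a' b' = pencilMatrix N a' b' * pencilMatrix M a b := by
  have hMN : Commute (M.map (MvPolynomial.C : ℂ →+* Cox)) (N.map (MvPolynomial.C : ℂ →+* Cox)) := by
    change _ * _ = _ * _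
    rw [← Matrix.map_mul, ← Matrix.map_mul, h]
  have hs (x : Cox) (X : Matrix (Fin c) (Fin c) Cox) : Commute (Matrix.scalar (Fin c) x) X :=
    Matrix.scalar_commute _ (fun _ => Commute.all _ _) _
  exact ((hs a _).add_left ((hs a' _).symm.add_right ((hMN.smul_left b).smul_right b'))).eq

end Hirzebruch

end

theorem mainTheorem8 (n : ℕ) (hn : 1 ≤ n) (c : ℕ)
    {V : Type*} [AddCommGroup V] [Module ℂ V] (B : Module.Basis (Fin c) ℂ V)
    (b₁ b₂ : Module.End ℂ V) (hb : Commute b₁ b₂)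
    (y₁ y₂ : Hirzebruch.GlobalSections n (0, 1)) (hy : LinearIndependent ℂ ![y₁, y₂])
    (sE : Hirzebruch.GlobalSections n (1, -(n : ℤ))) (hsE : sE ≠ 0)
    (sInf : Hirzebruch.GlobalSections n (1, 0)) (hsInf : Irreducible (sInf : Hirzebruch.Cox)) :
    CategoryTheory.Limits.IsZero
        ((Hirzebruch.complexM B b₁ b₂ y₁ y₂ sE sInf hb).homology (-1)) ∧
      CategoryTheory.Limits.IsZero
        ((Hirzebruch.complexM B b₁ b₂ y₁ y₂ sE sInf hb).homology 0) := by
  open Hirzebruch in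
  let M := LinearMap.toMatrix B.dualBasis B.dualBasis b₁.dualMap
  let N := LinearMap.toMatrix B.dualBasis B.dualBasis b₂.dualMap
  obtain ⟨hdet, hrel⟩ := isRelPrime_det hn M N hy hsE hsInf
  have hMN : N * M = M * N := by
    rw [← LinearMap.toMatrix_mul, ← LinearMap.toMatrix_mul]
    congr 1
    exact LinearMap.ext fun f => LinearMap.ext fun v => congrArg f (LinearMap.congr_fun hb.eq v)
  have hQ := pencilMatrix_mem M y₁ y₂
  have hP := pencilMatrix_mem N (powMul y₂ sE) sInf
  constructor
  · have hm : Mono (pencil B.dualBasis 1 b₁.dualMap y₁ y₂ (d := (0, -1)) (d' := (0, 0))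
        (by simp)) := by
      rw [pencil_eq_matMap]
      exact mono_matMap n hQ hdet _
    have : Mono (alpha B b₁ b₂ y₁ y₂ sE sInf) := by
      have h : alpha B b₁ b₂ y₁ y₂ sE sInf ≫ biprod.snd =
          pencil B.dualBasis 1 b₁.dualMap y₁ y₂ (by simp) := biprod.lift_snd _ _
      rw [← h] at hm
      exact mono_of_mono _ biprod.snd
    exact isZero_homology_threeTerm_neg_one _ _ _
  · refine isZero_homology_threeTerm_zero _ _ _ fun x hx => ?_
    rw [beta, biprod.desc_eq, Preadditive.comp_add, Preadditive.comp_neg, Preadditive.comp_neg,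
      add_neg_eq_zero, pencil_eq_matMap, pencil_eq_matMap, ← Category.assoc,
      ← Category.assoc] at hx
    obtain ⟨z, hz₁, hz₂⟩ := exists_comp_matMap_eq n hQ hP (pencilMatrix_mul_comm hMN _ _ _ _)
      hdet hrel (d := (0, -1)) _ _ (by simp) (by simp) _ _ hx
    refine ⟨z, biprod.hom_ext _ _ ?_ ?_⟩
    · rw [alpha, Category.assoc, biprod.lift_fst, pencil_eq_matMap, hz₁]
    · rw [alpha, Category.assoc, biprod.lift_snd, pencil_eq_matMap, hz₂]
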